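/- **Setting.** A first-order language $\mathscr L$ consists of a set $\mathscr L_q$ of quantifier symbols and, for each $n\in\mathbb N$, a set $\mathscr L_n$ of $n$-ary connectives, with designated $e\in\mathscr L_0$ and $\otimes\in\mathscr L_2$. All signatures and all prop-categories below are small. *Syntax.* A (many-sorted) signature $Sg$ has sorts, function symbols $f:\sigma_1,\dots,\sigma_n\to\tau$ and relation symbols $R\subseteq\sigma_1,\dots,\sigma_n$. Terms in a context $\Gamma=x_1:\sigma_1,\dots,x_n:\sigma_n$ are built from variables and function symbols; formulas in context are built from relation symbols applied to terms, equations $M=_\tau N$, connectives, and quantifications $\Omega_{x:\sigma}\varphi\ [\Gamma]$ with $\Omega\in\mathscr L_q$ and $\varphi\ [\Gamma,x:\sigma]$. Assertions are equations $M=N:\tau\ [\Gamma]$ and sequents $\varphi_1,\dots,\varphi_n\vdash\psi\ [\Gamma]$. An $Sg$-theory is a set of $Sg$-assertions. A logic is a family of closure operators on the $Sg$-theories, one for each signature $Sg$; $T\vdash T'$ means that $T'$ is contained in the closure of $T$. *Prop-categories.* $\mathrm{Ob}(\mathbf{FA})$ is the class of pairs $(\mathcal C,P)$, where $\mathcal C$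 is a category with designated finite products and $P:\mathcal C^{op}\to\mathbf{Pos}$ is a functor, such that: each $P(c)$ carries an operation for each connective in $\mathscr L$ (not assumed monotone), preserved by all $P(f)$, and $(P(c),\otimes,e)$ is a monoid; for each $c$ there is a designated element $Eq_c\in P(c\times c)$; for each quantifier $\Omega$ and each $c$ there are functions $\Omega_{b,c}:P(b\times c)\to P(b)$ natural in $b$, with $$\Omega_{b,1}\circ P(\pi_1)=\mathrm{id}_{P(b)},\qquad \Omega_{b,c\times d}\circ P(a_{b,c,d})=\Omega_{b,c}\circ\Omega_{b\times c,d},$$ where $a_{b,c,d}:b\times(c\times d)\cong(b\times c)\times d$; and $Eq_1=e$, while for $c=c_1\times c_2$, $$Eq_{c}=P(\langle\pi_1\pi_1^{c,c},\pi_1\pi_2^{c,c}\rangle)Eq_{c_1}\otimes P(\langle\pi_2\pi_1^{c,c},\pi_2\pi_2^{c,c}\rangle)Eq_{c_2}.$$ A morphism $F:(\mathcal D,Q)\to(\mathcal C,P)$ is a finite-product-preserving functor $F^o$ together with a natural family of monotone maps $F^p_d:Q(d)\to P(F^od)$ that preserve the connectives and, up to the change-of-product isomorphisms, the quantifiers and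 equality. $(\mathcal D,Q)$ is a subprop-category of $(\mathcal C,P)$ if there is such an $F$ with $F^o$ faithful and each $F^p_d$ an order embedding. The product of a small family of prop-categories is formed componentwise (the empty product is the terminal prop-category). *Semantics.* An $Sg$-structure in $(\mathcal C,P)$ assigns objects to sorts, morphisms out of products to function symbols, and elements of $P$ over products to relation symbols. Terms and formulas in context are then interpreted in the usual way, $M=_\tau N$ by $P(\langle M,N\rangle)(Eq_\tau)$ and $\Omega_{x:\sigma}\varphi\ [\Gamma]$ by $\Omega_{\Gamma,\sigma}$ of $\varphi$. An equation is satisfied if both sides have the same interpretation, and $\varphi_1,\dots,\varphi_n\vdash\psi$ is satisfied if $\varphi_1\otimes\cdots\otimes\varphi_n\le\psi$ (with $e$ on the left for $n=0$). For a class $\mathcal X\subseteq\mathrm{Ob}(\mathbf{FA})$, the logic $\vDash_{\mathcal X}$ is given by: $T\vDash_{\mathcal X}T'$ iff every structure in a member of $\mathcal X$ that satisfies $T$ satisfies $T'$. For a logic $\mathcal L$, $\mathrm{Ob}(\mathbf{FA}_{\mathcal L})$ is the class of prop-categories $\mathcal A$ such that $T\vdash_{\mathcal L}T'$ implies $T\vDash_{\{\mathcal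 A\}}T'$, for all signatures and all theories $T,T'$. *Classifying prop-categories.* Let $\mathcal L^m$ be the logic given by the rules of equational logic and the following sequent rules: $\varphi\vdash\varphi$; from $\varphi\vdash\psi$ and $\psi\vdash\theta$ infer $\varphi\vdash\theta$; weakening of the context; from $M=M'$ and $\Phi\vdash\psi$ infer $\Phi[M/x]\vdash\psi[M'/x]$; congruence of each quantifier and of each connective with respect to interderivability; the two-way rules exchanging $\Phi,\alpha,\beta,\Psi\vdash\theta$ with $\Phi,\alpha\otimes\beta,\Psi\vdash\theta$, and $\Phi,e,\Psi\vdash\theta$ with $\Phi,\Psi\vdash\theta$. If $T$ is an $\mathcal L^m$-theory (an $Sg$-theory, for some $Sg$, closed under these rules), its classifying prop-category $(\mathcal C_T,P_T)$ has contexts as objects, lists of terms modulo provable equality as morphisms, juxtaposition of contexts as product, and $P_T(\Gamma)$ the formulas in context $\Gamma$ modulo interderivability, ordered by derivability. Substitution gives $P_T$ on morphisms, the connectives act syntactically, $\Omega_{\Gamma,\Delta}$ quantifies over all variables of $\Delta$, and $Eq_\Gamma$ is $x_1=x_1'\otimes\cdots\otimes x_n=x_n'$ (or $e$ for $n=0$).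 *Operators.* For $\mathcal X\subseteq\mathrm{Ob}(\mathbf{FA})$ let $\mathbb P(\mathcal X)$ be the closure of $\mathcal X$ under products of small families, $\mathbb S(\mathcal X)$ the closure of $\mathcal X$ under subprop-categories, and $\mathbb U(\mathcal X)$ the class of those $(\mathcal D,Q)\in\mathrm{Ob}(\mathbf{FA})$ such that every classifying prop-category $(\mathcal C_T,P_T)$ (for any signature) which is a subprop-category of $(\mathcal D,Q)$ belongs to $\mathcal X$. **Theorem.** For every class $\mathcal X\subseteq\mathrm{Ob}(\mathbf{FA})$, $$\mathrm{Ob}(\mathbf{FA}_{\vDash_{\mathcal X}})=\mathbb U\,\mathbb S\,\mathbb P(\mathcal X),$$ and this is the largest class $\mathcal Y\subseteq\mathrm{Ob}(\mathbf{FA})$ with $\vDash_{\mathcal Y}\,=\,\vDash_{\mathcal X}$. -/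

import Mathlib

universe u

namespace FiberedLogic

open CategoryTheory MonoidalCategory CartesianMonoidalCategory Limits

noncomputable section

/-! ### First-order languages, signatures, terms and formulas in context

Contexts, terms and formulas are taken up to renaming of free and bound variables: they are
nameless (de Bruijn). A context is the list of its sorts, with the most recent variable at the
head, so that the extension of `Γ` by a variable of sort `σ` is `σ :: Γ`, and the juxtaposition of
`Γ` followed by `Δ` is `Δ ++ Γ`. -/

/-- A first-order language: quantifier symbols, and propositional connectives with arities, among
them a designated constant `e` and a designated binary connective `⊗`. -/
structure FOLanguage where
  /-- quantifier symbols -/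
  Quant : Type u
  /-- propositional connectives of each arity -/
  Conn : ℕ → Type u
  /-- the designated nullary connective `e` -/
  unit : Conn 0
  /-- the designated binary connective `⊗` -/
  tensor : Conn 2

/-- A many-sorted signature: sorts, and typed function and relation symbols. -/
structure Signature where
  /-- sort symbols -/
  Srt : Type u
  /-- function symbols `f : σ₁, …, σₙ → τ` -/
  Fn : List Srt → Srt → Type u
  /-- relation symbols `R ⊆ σ₁, …, σₙ` -/
  Rel : List Srt → Type u

/-- `Var Γ σ`: the variables of sort `σ` in the context `Γ`. -/
inductive Var {S : Type u} : List S → S → Type u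
  | zero {Γ : List S} {σ : S} : Var (σ :: Γ) σ
  | succ {Γ : List S} {σ τ : S} : Var Γ σ → Var (τ :: Γ) σ

/-- Terms in context `Γ`. The arguments of `f : σ₁, …, σₙ → τ` are a family of terms indexed by
the positions of the list `σ₁, …, σₙ`. -/
inductive Term (Sg : Signature.{u}) (Γ : List Sg.Srt) : Sg.Srt → Type u
  | var {σ : Sg.Srt} (v : Var Γ σ) : Term Sg Γ σ
  | app {as : List Sg.Srt} {τ : Sg.Srt} (f : Sg.Fn as τ)
      (args : ∀ σ : Sg.Srt, Var as σ → Term Sg Γ σ) : Term Sg Γ τ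

/-- A list of terms in context `Γ`, one for each variable of `Δ`. -/
abbrev Subst (Sg : Signature.{u}) (Γ Δ : List Sg.Srt) : Type u :=
  ∀ σ : Sg.Srt, Var Δ σ → Term Sg Γ σ

/-- Formulas in context. -/
inductive Formula (L : FOLanguage.{u}) (Sg : Signature.{u}) : List Sg.Srt → Type u
  | rel {Γ as : List Sg.Srt} (R : Sg.Rel as) (args : Subst Sg Γ as) : Formula L Sg Γ
  | eq {Γ : List Sg.Srt} {τ : Sg.Srt} (M N : Term Sg Γ τ) : Formula L Sg Γ
  | conn {Γ : List Sg.Srt} {n : ℕ} (k : L.Conn n) (φ : Fin n → Formula L Sg Γ) : Formula L Sg Γ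
  | quant {Γ : List Sg.Srt} (q : L.Quant) (σ : Sg.Srt) (φ : Formula L Sg (σ :: Γ)) :
      Formula L Sg Γ

variable {L : FOLanguage.{u}} {Sg : Signature.{u}}

/-- Simultaneous substitution in a term. -/
def Term.subst {Γ Δ : List Sg.Srt} (γ : Subst Sg Γ Δ) : ∀ {σ : Sg.Srt}, Term Sg Δ σ → Term Sg Γ σ
  | _, .var v => γ _ v
  | _, .app f args => .app f (fun σ v => (args σ v).subst γ)

namespace Subst

/-- The identity list of terms, given by the variables. -/
def id (Γ : List Sg.Srt) : Subst Sg Γ Γ := fun _ v => .var v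

/-- Composition is componentwise substitution. -/
def comp {Γ Δ Θ : List Sg.Srt} (γ : Subst Sg Γ Δ) (δ : Subst Sg Δ Θ) : Subst Sg Γ Θ :=
  fun σ v => (δ σ v).subst γ

/-- The variables of `Γ`, in the context `Γ` extended by a further variable. -/
def wk (Γ : List Sg.Srt) (τ : Sg.Srt) : Subst Sg (τ :: Γ) Γ := fun _ v => .var (.succ v)

/-- The list `γ` followed by the term `M`. -/
def cons {Γ Δ : List Sg.Srt} {τ : Sg.Srt} (γ : Subst Sg Γ Δ) (M : Term Sg Γ τ) :
    Subst Sg Γ (τ :: Δ)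
  | _, .zero => M
  | _, .succ v => γ _ v

/-- The extension of `γ` under a binder. -/
def up {Γ Δ : List Sg.Srt} (γ : Subst Sg Γ Δ) (τ : Sg.Srt) : Subst Sg (τ :: Γ) (τ :: Δ) :=
  cons (comp (wk Γ τ) γ) (.var .zero)

/-- The list `γ` followed by the list `δ`. -/
def append {Θ Γ : List Sg.Srt} (γ : Subst Sg Θ Γ) :
    ∀ {Δ : List Sg.Srt}, Subst Sg Θ Δ → Subst Sg Θ (Δ ++ Γ)
  | [], _ => γ
  | _ :: _, δ => cons (append γ (fun σ v => δ σ v.succ)) (δ _ .zero)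

/-- The variables of `Γ` in the context `Γ` followed by `Δ`. -/
def fst (Γ : List Sg.Srt) : ∀ Δ : List Sg.Srt, Subst Sg (Δ ++ Γ) Γ
  | [] => id Γ
  | σ :: Δ => comp (wk (Δ ++ Γ) σ) (fst Γ Δ)

/-- The variables of `Δ` in the context `Γ` followed by `Δ`. -/
def snd (Γ : List Sg.Srt) : ∀ Δ : List Sg.Srt, Subst Sg (Δ ++ Γ) Δ
  | [] => fun _ v => nomatch v
  | σ :: Δ => up (snd Γ Δ) σ

end Subst

/-- Simultaneous capture-avoiding substitution in a formula. -/
def Formula.subst : ∀ {Γ Δ : List Sg.Srt}, Subst Sg Γ Δ → Formula L Sg Δ → Formula L Sg Γ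
  | _, _, γ, .rel R args => .rel R (γ.comp args)
  | _, _, γ, .eq M N => .eq (M.subst γ) (N.subst γ)
  | _, _, γ, .conn k φ => .conn k (fun i => (φ i).subst γ)
  | _, _, γ, .quant q σ φ => .quant q σ (φ.subst (γ.up σ))

/-- The formula `φ ⊗ ψ`. -/
def Formula.tens {Γ : List Sg.Srt} (φ ψ : Formula L Sg Γ) : Formula L Sg Γ :=
  .conn L.tensor ![φ, ψ]

/-- The formula `e`. -/
def Formula.unit (Γ : List Sg.Srt) : Formula L Sg Γ := .conn L.unit ![]

/-- The formula `Ω_{y₁ : τ₁} … Ω_{yₘ : τₘ} φ`, where `Δ` is the context `y₁ : τ₁, …, yₘ : τₘ`. -/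
def Formula.quantAll (q : L.Quant) {Γ : List Sg.Srt} :
    ∀ Δ : List Sg.Srt, Formula L Sg (Δ ++ Γ) → Formula L Sg Γ
  | [], φ => φ
  | σ :: Δ, φ => quantAll q Δ (.quant q σ φ)

/-- The formula `M₁ = N₁ ⊗ … ⊗ Mₙ = Nₙ` (preceded by `e`) for two lists of terms. -/
def Formula.eqAll {Γ : List Sg.Srt} :
    ∀ {Δ : List Sg.Srt}, Subst Sg Γ Δ → Subst Sg Γ Δ → Formula L Sg Γ
  | [], _, _ => .unit Γ
  | _ :: _, γ, δ =>
    .tens (eqAll (fun σ v => γ σ v.succ) (fun σ v => δ σ v.succ)) (.eq (γ _ .zero) (δ _ .zero))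

/-! #### Substitution calculus -/

namespace Subst

theorem ext_cons {Γ Δ : List Sg.Srt} {τ : Sg.Srt} {γ δ : Subst Sg Γ (τ :: Δ)}
    (h0 : γ _ .zero = δ _ .zero) (hs : ∀ σ (v : Var Δ σ), γ σ v.succ = δ σ v.succ) : γ = δ := by
  funext σ v
  cases v with
  | zero => exact h0
  | succ v => exact hs _ v

theorem ext_nil {Γ : List Sg.Srt} (γ δ : Subst Sg Γ []) : γ = δ := by
  funext σ v
  exact nomatch v

end Subst

theorem Term.subst_id {Γ : List Sg.Srt} {σ : Sg.Srt} (M : Term Sg Γ σ) :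
    M.subst (Subst.id Γ) = M := by
  induction M with
  | var v => rfl
  | app f args ih => simp only [Term.subst, ih]

theorem Term.subst_subst {Γ Δ Θ : List Sg.Srt} (γ : Subst Sg Γ Δ) (δ : Subst Sg Δ Θ)
    {σ : Sg.Srt} (M : Term Sg Θ σ) : (M.subst δ).subst γ = M.subst (γ.comp δ) := by
  induction M with
  | var v => rfl
  | app f args ih => simp only [Term.subst, ih]

namespace Subst

theorem id_comp {Γ Δ : List Sg.Srt} (γ : Subst Sg Γ Δ) : (id Γ).comp γ = γ := by
  funext σ v
  exact Term.subst_id _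

theorem comp_id {Γ Δ : List Sg.Srt} (γ : Subst Sg Γ Δ) : γ.comp (id Δ) = γ := rfl

theorem comp_assoc {Γ Δ Θ Ξ : List Sg.Srt} (γ : Subst Sg Γ Δ) (δ : Subst Sg Δ Θ)
    (θ : Subst Sg Θ Ξ) : (γ.comp δ).comp θ = γ.comp (δ.comp θ) := by
  funext σ v
  exact (Term.subst_subst _ _ _).symm

theorem cons_wk {Γ Δ : List Sg.Srt} {τ : Sg.Srt} (γ : Subst Sg Γ Δ) (M : Term Sg Γ τ) :
    (cons γ M).comp (wk Δ τ) = γ := rfl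

theorem up_wk {Γ Δ : List Sg.Srt} (τ : Sg.Srt) (γ : Subst Sg Γ Δ) :
    (up γ τ).comp (wk Δ τ) = (wk Γ τ).comp γ := rfl

theorem up_id (Γ : List Sg.Srt) (τ : Sg.Srt) : up (id Γ) τ = id (τ :: Γ) :=
  ext_cons rfl (fun _ _ => rfl)

theorem up_comp {Γ Δ Θ : List Sg.Srt} (τ : Sg.Srt) (γ : Subst Sg Γ Δ) (δ : Subst Sg Δ Θ) :
    up (γ.comp δ) τ = (up γ τ).comp (up δ τ) := by
  refine ext_cons rfl (fun σ v => ?_)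
  show ((δ σ v).subst γ).subst (wk Γ τ) = ((δ σ v).subst (wk Δ τ)).subst (up γ τ)
  rw [Term.subst_subst, Term.subst_subst, up_wk]

theorem append_fst {Θ Γ : List Sg.Srt} (γ : Subst Sg Θ Γ) :
    ∀ {Δ : List Sg.Srt} (δ : Subst Sg Θ Δ), (append γ δ).comp (fst Γ Δ) = γ
  | [], _ => rfl
  | σ :: Δ, δ => by
    show (append γ δ).comp ((wk (Δ ++ Γ) σ).comp (fst Γ Δ)) = γ
    rw [← comp_assoc]
    exact append_fst γ (fun σ v => δ σ v.succ)

theorem append_snd {Θ Γ : List Sg.Srt} (γ : Subst Sg Θ Γ) :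
    ∀ {Δ : List Sg.Srt} (δ : Subst Sg Θ Δ), (append γ δ).comp (snd Γ Δ) = δ
  | [], _ => ext_nil _ _
  | σ :: Δ, δ => by
    refine ext_cons rfl (fun τ v => ?_)
    show ((snd Γ Δ τ v).subst (wk (Δ ++ Γ) σ)).subst (append γ δ) = δ τ v.succ
    rw [Term.subst_subst]
    exact congrFun (congrFun (append_snd γ (fun σ v => δ σ v.succ)) τ) v

/-- Induction on the variables of a juxtaposition of contexts. -/
theorem append_ind {Γ : List Sg.Srt} :
    ∀ {Δ : List Sg.Srt} {p : ∀ σ, Var (Δ ++ Γ) σ → Prop},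
      (∀ σ (v : Var Γ σ), ∃ w, fst Γ Δ σ v = .var w ∧ p σ w) →
      (∀ σ (v : Var Δ σ), ∃ w, snd Γ Δ σ v = .var w ∧ p σ w) → ∀ σ v, p σ v
  | [], p, hf, _, σ, v => by
    obtain ⟨w, hw, hp⟩ := hf σ v
    cases hw
    exact hp
  | τ :: Δ, p, hf, hs, σ, v => by
    cases v with
    | zero =>
      obtain ⟨w, hw, hp⟩ := hs _ .zero
      cases hw
      exact hp
    | succ v =>
      refine append_ind (Δ := Δ) (p := fun σ v => p σ v.succ) (fun σ v => ?_) (fun σ v => ?_) σ v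
      · obtain ⟨w, hw, hp⟩ := hf σ v
        change (fst Γ Δ σ v).subst (wk (Δ ++ Γ) τ) = _ at hw
        generalize fst Γ Δ σ v = M at hw
        cases M with
        | var w' => cases hw; exact ⟨w', rfl, hp⟩
        | app f args => exact absurd hw (by simp [Term.subst])
      · obtain ⟨w, hw, hp⟩ := hs σ v.succ
        change (snd Γ Δ σ v).subst (wk (Δ ++ Γ) τ) = _ at hw
        generalize snd Γ Δ σ v = M at hw
        cases M with
        | var w' => cases hw; exact ⟨w', rfl, hp⟩
        | app f args => exact absurd hw (by simp [Term.subst])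

/-- The variables of `Γ` and `Δ`, seen in the juxtaposition of both, are variables. -/
theorem fst_eq_var {Γ : List Sg.Srt} :
    ∀ {Δ : List Sg.Srt} {σ : Sg.Srt} (v : Var Γ σ), ∃ w, fst Γ Δ σ v = .var w
  | [], _, v => ⟨v, rfl⟩
  | τ :: Δ, σ, v => by
    obtain ⟨w, hw⟩ := fst_eq_var (Δ := Δ) v
    refine ⟨w.succ, ?_⟩
    show (fst Γ Δ σ v).subst (wk (Δ ++ Γ) τ) = _
    rw [hw]
    rfl

theorem snd_eq_var {Γ : List Sg.Srt} :
    ∀ {Δ : List Sg.Srt} {σ : Sg.Srt} (v : Var Δ σ), ∃ w, snd Γ Δ σ v = .var w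
  | τ :: Δ, _, .zero => ⟨.zero, rfl⟩
  | τ :: Δ, σ, .succ v => by
    obtain ⟨w, hw⟩ := snd_eq_var (Γ := Γ) v
    refine ⟨w.succ, ?_⟩
    show (snd Γ Δ σ v).subst (wk (Δ ++ Γ) τ) = _
    rw [hw]
    rfl

theorem append_ext_rel {Θ Γ Δ : List Sg.Srt} {r : ∀ σ, Term Sg Θ σ → Term Sg Θ σ → Prop}
    {γ δ : Subst Sg Θ (Δ ++ Γ)}
    (hf : ∀ σ v, r σ (γ.comp (fst Γ Δ) σ v) (δ.comp (fst Γ Δ) σ v))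
    (hs : ∀ σ v, r σ (γ.comp (snd Γ Δ) σ v) (δ.comp (snd Γ Δ) σ v)) :
    ∀ σ v, r σ (γ σ v) (δ σ v) := by
  refine append_ind (fun σ v => ?_) (fun σ v => ?_)
  · obtain ⟨w, hw⟩ := fst_eq_var (Δ := Δ) v
    have := hf σ v
    simp only [comp, hw] at this
    exact ⟨w, hw, this⟩
  · obtain ⟨w, hw⟩ := snd_eq_var (Γ := Γ) v
    have := hs σ v
    simp only [comp, hw] at this
    exact ⟨w, hw, this⟩

theorem append_ext {Θ Γ Δ : List Sg.Srt} {γ δ : Subst Sg Θ (Δ ++ Γ)}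
    (hf : γ.comp (fst Γ Δ) = δ.comp (fst Γ Δ)) (hs : γ.comp (snd Γ Δ) = δ.comp (snd Γ Δ)) :
    γ = δ := by
  funext σ v
  exact append_ext_rel (r := fun _ M N => M = N)
    (fun σ v => congrFun (congrFun hf σ) v) (fun σ v => congrFun (congrFun hs σ) v) σ v

theorem comp_append {Ξ Θ Γ Δ : List Sg.Srt} (θ : Subst Sg Ξ Θ) (γ : Subst Sg Θ Γ)
    (δ : Subst Sg Θ Δ) : θ.comp (append γ δ) = append (θ.comp γ) (θ.comp δ) := by
  apply append_ext
  · rw [comp_assoc, append_fst, append_fst]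
  · rw [comp_assoc, append_snd, append_snd]

/-- Extension of `γ` by a list of new variables, by iteration and as a product of lists. -/
theorem up_append {Γ Γ' Δ : List Sg.Srt} (γ : Subst Sg Γ Γ') (τ : Sg.Srt) :
    append ((fst Γ (τ :: Δ)).comp γ) (snd Γ (τ :: Δ)) =
      up (append ((fst Γ Δ).comp γ) (snd Γ Δ)) τ := by
  refine ext_cons rfl (fun σ v => ?_)
  have := comp_append (wk (Δ ++ Γ) τ) ((fst Γ Δ).comp γ) (snd Γ Δ)
  rw [← comp_assoc] at this
  exact (congrFun (congrFun this σ) v).symm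

/-- The change-of-product list for the two bracketings of three contexts. -/
def assocInv (Γ Δ Θ : List Sg.Srt) : Subst Sg ((Θ ++ Δ) ++ Γ) (Θ ++ (Δ ++ Γ)) :=
  append (append (fst Γ (Θ ++ Δ)) ((snd Γ (Θ ++ Δ)).comp (fst Δ Θ)))
    ((snd Γ (Θ ++ Δ)).comp (snd Δ Θ))

theorem assocInv_nil (Γ Δ : List Sg.Srt) : assocInv Γ Δ [] = id (Δ ++ Γ) := by
  apply append_ext (Γ := Γ) (Δ := Δ)
  · exact (append_fst _ _).trans (id_comp _).symm
  · exact (append_snd _ _).trans (id_comp _).symm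

theorem assocInv_cons (Γ Δ Θ : List Sg.Srt) (τ : Sg.Srt) :
    assocInv Γ Δ (τ :: Θ) = up (assocInv Γ Δ Θ) τ := by
  refine ext_cons rfl (fun σ v => ?_)
  have := comp_append (wk ((Θ ++ Δ) ++ Γ) τ)
    (append (fst Γ (Θ ++ Δ)) ((snd Γ (Θ ++ Δ)).comp (fst Δ Θ)))
    ((snd Γ (Θ ++ Δ)).comp (snd Δ Θ))
  rw [comp_append _ (fst Γ (Θ ++ Δ))] at this
  refine Eq.trans ?_ (congrFun (congrFun this σ) v).symm
  have h1 : (snd Γ (τ :: (Θ ++ Δ))).comp (fst Δ (τ :: Θ)) =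
      (wk ((Θ ++ Δ) ++ Γ) τ).comp ((snd Γ (Θ ++ Δ)).comp (fst Δ Θ)) := by
    show (up (snd Γ (Θ ++ Δ)) τ).comp ((wk (Θ ++ Δ) τ).comp (fst Δ Θ)) = _
    rw [← comp_assoc, up_wk, comp_assoc]
  have h2 : (fun σ v => ((snd Γ (τ :: (Θ ++ Δ))).comp (snd Δ (τ :: Θ))) σ (Var.succ v)) =
      (wk ((Θ ++ Δ) ++ Γ) τ).comp ((snd Γ (Θ ++ Δ)).comp (snd Δ Θ)) := by
    show (up (snd Γ (Θ ++ Δ)) τ).comp ((wk (Θ ++ Δ) τ).comp (snd Δ Θ)) = _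
    rw [← comp_assoc, up_wk, comp_assoc]
  show append (append _ ((snd Γ (τ :: (Θ ++ Δ))).comp (fst Δ (τ :: Θ))))
    (fun σ v => ((snd Γ (τ :: (Θ ++ Δ))).comp (snd Δ (τ :: Θ))) σ (Var.succ v)) σ v = _
  rw [h1, h2]
  rfl

end Subst

namespace Formula

open Subst

theorem subst_id : ∀ {Γ : List Sg.Srt} (φ : Formula L Sg Γ), φ.subst (Subst.id Γ) = φ
  | _, .rel R args => by simp only [Formula.subst, id_comp]
  | _, .eq M N => by simp only [Formula.subst, Term.subst_id]
  | _, .conn k φ => by simp only [Formula.subst, fun i => subst_id (φ i)]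
  | _, .quant q σ φ => by simp only [Formula.subst, up_id, subst_id φ]

theorem subst_subst : ∀ {Γ Δ Θ : List Sg.Srt} (γ : Subst Sg Γ Δ) (δ : Subst Sg Δ Θ)
    (φ : Formula L Sg Θ), (φ.subst δ).subst γ = φ.subst (γ.comp δ)
  | _, _, _, γ, δ, .rel R args => by simp only [Formula.subst, comp_assoc]
  | _, _, _, γ, δ, .eq M N => by simp only [Formula.subst, Term.subst_subst]
  | _, _, _, γ, δ, .conn k φ => by simp only [Formula.subst, fun i => subst_subst γ δ (φ i)]
  | _, _, _, γ, δ, .quant q σ φ => by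
    simp only [Formula.subst, up_comp, subst_subst (γ.up σ) (δ.up σ) φ]

theorem tens_subst {Γ Δ : List Sg.Srt} (γ : Subst Sg Γ Δ) (φ ψ : Formula L Sg Δ) :
    (tens φ ψ).subst γ = tens (φ.subst γ) (ψ.subst γ) := by
  simp only [tens, Formula.subst]
  congr 1
  funext i
  fin_cases i <;> rfl

theorem unit_subst {Γ Δ : List Sg.Srt} (γ : Subst Sg Γ Δ) :
    (unit (L := L) Δ).subst γ = unit Γ := by
  simp only [unit, Formula.subst]
  congr 1
  funext i
  exact i.elim0

theorem quantAll_subst (q : L.Quant) {Γ Γ' : List Sg.Srt} (γ : Subst Sg Γ Γ') :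
    ∀ (Δ : List Sg.Srt) (φ : Formula L Sg (Δ ++ Γ')),
      (quantAll q Δ φ).subst γ =
        quantAll q Δ (φ.subst (append ((Subst.fst Γ Δ).comp γ) (Subst.snd Γ Δ)))
  | [], φ => by
    show φ.subst γ = φ.subst ((Subst.id Γ).comp γ)
    rw [id_comp]
  | τ :: Δ, φ => by
    rw [up_append]
    exact quantAll_subst q γ Δ (.quant q τ φ)

theorem quantAll_append (q : L.Quant) {Γ Δ : List Sg.Srt} :
    ∀ (Θ : List Sg.Srt) (φ : Formula L Sg (Θ ++ (Δ ++ Γ))),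
      quantAll q (Θ ++ Δ) (φ.subst (assocInv Γ Δ Θ)) = quantAll q Δ (quantAll q Θ φ)
  | [], φ => by
    rw [assocInv_nil]
    exact congrArg _ (subst_id (Γ := Δ ++ Γ) φ)
  | τ :: Θ, φ => by
    rw [assocInv_cons]
    exact quantAll_append q Θ (.quant q τ φ)

theorem eqAll_subst {Γ Γ' : List Sg.Srt} (θ : Subst Sg Γ Γ') :
    ∀ {Δ : List Sg.Srt} (γ δ : Subst Sg Γ' Δ),
      (eqAll (L := L) γ δ).subst θ = eqAll (θ.comp γ) (θ.comp δ)
  | [], _, _ => unit_subst θ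
  | σ :: Δ, γ, δ => by
    simp only [eqAll, tens_subst, eqAll_subst θ]
    rfl

end Formula


/-! ### Assertions, theories and logics -/

/-- Equations in context `M = N : τ [Γ]` and sequents in context `φ₁, …, φₙ ⊢ ψ [Γ]`. -/
inductive Assertion (L : FOLanguage.{u}) (Sg : Signature.{u}) : Type u
  | eqn {Γ : List Sg.Srt} {τ : Sg.Srt} (M N : Term Sg Γ τ) : Assertion L Sg
  | seq {Γ : List Sg.Srt} (Φ : List (Formula L Sg Γ)) (ψ : Formula L Sg Γ) : Assertion L Sg

/-- An `Sg`-theory is a collection of `Sg`-assertions; theories are ordered by inclusion. -/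
abbrev Theory (L : FOLanguage.{u}) (Sg : Signature.{u}) : Type u := Set (Assertion L Sg)

/-- A first-order logic: a closure operator on the lattice of `Sg`-theories for each `Sg`. -/
abbrev Logic (L : FOLanguage.{u}) : Type (u + 1) :=
  ∀ Sg : Signature.{u}, ClosureOperator (Theory L Sg)

/-- `T ⊢ T'` in the logic `K`: the theory `T'` is contained in the closure of `T`. -/
def Logic.Derives (K : Logic L) (Sg : Signature.{u}) (T T' : Theory L Sg) : Prop :=
  T' ≤ K Sg T

/-- The theories of the minimal logic: those closed under the rules of equational logic and under
the rules Ax, Cut, Cwk, Sub, `Ω`-Con, `◇`-Cong, `⊗`-Ref and `e`-Ref. The two substitution rules are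
stated for the simultaneous substitution of a list of terms, which for nameless contexts is
interderivable with the substitution of one variable at a time. -/
structure MinimalTheory (L : FOLanguage.{u}) (Sg : Signature.{u}) where
  /-- the assertions of the theory -/
  carrier : Theory L Sg
  eq_refl : ∀ {Γ : List Sg.Srt} {τ : Sg.Srt} (M : Term Sg Γ τ), .eqn M M ∈ carrier
  eq_symm : ∀ {Γ : List Sg.Srt} {τ : Sg.Srt} {M N : Term Sg Γ τ},
    .eqn M N ∈ carrier → .eqn N M ∈ carrier
  eq_trans : ∀ {Γ : List Sg.Srt} {τ : Sg.Srt} {M N K : Term Sg Γ τ},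
    .eqn M N ∈ carrier → .eqn N K ∈ carrier → .eqn M K ∈ carrier
  eq_sub : ∀ {Γ Δ : List Sg.Srt} {τ : Sg.Srt} {γ γ' : Subst Sg Γ Δ} {N N' : Term Sg Δ τ},
    (∀ σ v, .eqn (γ σ v) (γ' σ v) ∈ carrier) → .eqn N N' ∈ carrier →
      .eqn (N.subst γ) (N'.subst γ') ∈ carrier
  ax : ∀ {Γ : List Sg.Srt} (φ : Formula L Sg Γ), .seq [φ] φ ∈ carrier
  cut : ∀ {Γ : List Sg.Srt} {φ ψ θ : Formula L Sg Γ},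
    .seq [φ] ψ ∈ carrier → .seq [ψ] θ ∈ carrier → .seq [φ] θ ∈ carrier
  cwk : ∀ {Γ : List Sg.Srt} {Φ : List (Formula L Sg Γ)} {ψ : Formula L Sg Γ} (σ : Sg.Srt),
    .seq Φ ψ ∈ carrier →
      .seq (Φ.map (Formula.subst (Subst.wk Γ σ))) (ψ.subst (Subst.wk Γ σ)) ∈ carrier
  sub : ∀ {Γ Δ : List Sg.Srt} {γ γ' : Subst Sg Γ Δ} {Φ : List (Formula L Sg Δ)}
    {ψ : Formula L Sg Δ},
    (∀ σ v, .eqn (γ σ v) (γ' σ v) ∈ carrier) → .seq Φ ψ ∈ carrier →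
      .seq (Φ.map (Formula.subst γ)) (ψ.subst γ') ∈ carrier
  quant_con : ∀ {Γ : List Sg.Srt} (q : L.Quant) {σ : Sg.Srt} {φ ψ : Formula L Sg (σ :: Γ)},
    .seq [φ] ψ ∈ carrier → .seq [ψ] φ ∈ carrier →
      .seq [.quant q σ φ] (.quant q σ ψ) ∈ carrier
  conn_cong : ∀ {Γ : List Sg.Srt} {n : ℕ} (k : L.Conn n) {φ ψ : Fin n → Formula L Sg Γ},
    (∀ i, .seq [φ i] (ψ i) ∈ carrier) → (∀ i, .seq [ψ i] (φ i) ∈ carrier) →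
      .seq [.conn k φ] (.conn k ψ) ∈ carrier
  tensor_ref : ∀ {Γ : List Sg.Srt} (Φ Ψ : List (Formula L Sg Γ)) (α β θ : Formula L Sg Γ),
    .seq (Φ ++ α :: β :: Ψ) θ ∈ carrier ↔ .seq (Φ ++ .tens α β :: Ψ) θ ∈ carrier
  unit_ref : ∀ {Γ : List Sg.Srt} (Φ Ψ : List (Formula L Sg Γ)) (φ : Formula L Sg Γ),
    .seq (Φ ++ .unit Γ :: Ψ) φ ∈ carrier ↔ .seq (Φ ++ Ψ) φ ∈ carrier

/-! ### Prop-categories -/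

/-- The small prop-categories that interpret the language `L`, i.e. the objects of `FA`. The base
category has designated finite products `⊗` and `𝟙_`; `Pred` together with `reindex` is a
contravariant functor to posets. -/
structure PropCat (L : FOLanguage.{u}) where
  /-- objects of the base category -/
  Obj : Type u
  [cat : Category.{u} Obj]
  [prods : CartesianMonoidalCategory Obj]
  /-- the poset over an object -/
  Pred : Obj → Type u
  [ord : ∀ c, PartialOrder (Pred c)]
  /-- the monotone map between posets given by a morphism -/
  reindex : ∀ {c d : Obj}, (c ⟶ d) → Pred d →o Pred c
  reindex_id : ∀ {c : Obj} (r : Pred c), reindex (𝟙 c) r = r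
  reindex_comp : ∀ {b c d : Obj} (f : b ⟶ c) (g : c ⟶ d) (r : Pred d),
    reindex (f ≫ g) r = reindex f (reindex g r)
  /-- the operation on the poset over an object given by a connective -/
  conn : ∀ {n : ℕ}, L.Conn n → ∀ c : Obj, (Fin n → Pred c) → Pred c
  reindex_conn : ∀ {n : ℕ} (k : L.Conn n) {c d : Obj} (f : c ⟶ d) (r : Fin n → Pred d),
    reindex f (conn k d r) = conn k c (fun i => reindex f (r i))
  /-- the equality predicate -/
  eqPred : ∀ c : Obj, Pred (c ⊗ c)
  /-- the quantifier maps `Ω_{b,c}` -/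
  quant : L.Quant → ∀ b c : Obj, Pred (b ⊗ c) → Pred b
  quant_natural : ∀ (q : L.Quant) {b b' : Obj} (f : b ⟶ b') (c : Obj) (r : Pred (b' ⊗ c)),
    quant q b c (reindex (f ▷ c) r) = reindex f (quant q b' c r)
  tensor_assoc : ∀ (c : Obj) (r s t : Pred c),
    conn L.tensor c ![conn L.tensor c ![r, s], t] = conn L.tensor c ![r, conn L.tensor c ![s, t]]
  unit_tensor : ∀ (c : Obj) (r : Pred c), conn L.tensor c ![conn L.unit c ![], r] = r
  tensor_unit : ∀ (c : Obj) (r : Pred c), conn L.tensor c ![r, conn L.unit c ![]] = r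
  quant_one : ∀ (q : L.Quant) (b : Obj) (r : Pred b),
    quant q b (𝟙_ Obj) (reindex (fst b (𝟙_ Obj)) r) = r
  quant_prod : ∀ (q : L.Quant) (b c d : Obj) (r : Pred ((b ⊗ c) ⊗ d)),
    quant q b (c ⊗ d) (reindex (α_ b c d).inv r) = quant q b c (quant q (b ⊗ c) d r)
  eqPred_one : eqPred (𝟙_ Obj) = conn L.unit (𝟙_ Obj ⊗ 𝟙_ Obj) ![]
  eqPred_prod : ∀ c₁ c₂ : Obj,
    eqPred (c₁ ⊗ c₂) = conn L.tensor ((c₁ ⊗ c₂) ⊗ (c₁ ⊗ c₂))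
      ![reindex (lift (fst (c₁ ⊗ c₂) (c₁ ⊗ c₂) ≫ fst c₁ c₂)
          (snd (c₁ ⊗ c₂) (c₁ ⊗ c₂) ≫ fst c₁ c₂)) (eqPred c₁),
        reindex (lift (fst (c₁ ⊗ c₂) (c₁ ⊗ c₂) ≫ snd c₁ c₂)
          (snd (c₁ ⊗ c₂) (c₁ ⊗ c₂) ≫ snd c₁ c₂)) (eqPred c₂)]

attribute [instance] PropCat.cat PropCat.prods PropCat.ord

namespace PropCat

/-- The element `e` of the poset over `c`. -/
def unit (A : PropCat L) (c : A.Obj) : A.Pred c := A.conn L.unit c ![]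

/-- The product `r ⊗ s` in the poset over `c`. -/
def tens (A : PropCat L) {c : A.Obj} (r s : A.Pred c) : A.Pred c := A.conn L.tensor c ![r, s]

/-- The product `r₁ ⊗ … ⊗ rₙ`, which is `e` for `n = 0`. -/
def tensAll (A : PropCat L) {c : A.Obj} (rs : List (A.Pred c)) : A.Pred c :=
  rs.foldr A.tens (A.unit c)

/-- Morphisms of prop-categories: a functor that preserves finite products, and a natural family
of monotone homomorphisms that is compatible with quantifiers and equality, up to the
change-of-product isomorphisms. -/
structure Hom (A B : PropCat.{u} L) where
  /-- the functor between base categories -/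
  functor : A.Obj ⥤ B.Obj
  [preserves : PreservesFiniteProducts functor]
  /-- the maps between posets -/
  app : ∀ c : A.Obj, A.Pred c →o B.Pred (functor.obj c)
  naturality : ∀ {c d : A.Obj} (f : c ⟶ d) (r : A.Pred d),
    app c (A.reindex f r) = B.reindex (functor.map f) (app d r)
  app_conn : ∀ {n : ℕ} (k : L.Conn n) (c : A.Obj) (r : Fin n → A.Pred c),
    app c (A.conn k c r) = B.conn k (functor.obj c) (fun i => app c (r i))
  app_quant : ∀ (q : L.Quant) (b c : A.Obj) (r : A.Pred (b ⊗ c)),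
    app b (A.quant q b c r) = B.quant q (functor.obj b) (functor.obj c)
      (B.reindex (inv (CartesianMonoidalCategory.prodComparison functor b c)) (app (b ⊗ c) r))
  app_eqPred : ∀ c : A.Obj,
    app (c ⊗ c) (A.eqPred c) =
      B.reindex (CartesianMonoidalCategory.prodComparison functor c c) (B.eqPred (functor.obj c))

/-- `B` is a subprop-category of `A`: there is a morphism from `B` to `A` whose functor is faithful
and whose maps between posets are order embeddings. -/
def IsSubpropCategory (B A : PropCat.{u} L) : Prop :=
  ∃ i : Hom B A, i.functor.Faithful ∧ ∀ (d : B.Obj) (r s : B.Pred d),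
    i.app d r ≤ i.app d s ↔ r ≤ s

end PropCat

/-! ### Semantics -/

/-- The product of the interpretations of the sorts in a context. -/
def ctxObj (A : PropCat.{u} L) {S : Type u} (srt : S → A.Obj) : List S → A.Obj
  | [] => 𝟙_ A.Obj
  | σ :: Γ => ctxObj A srt Γ ⊗ srt σ

/-- An `Sg`-structure in the prop-category `A`. -/
structure Str (Sg : Signature.{u}) (A : PropCat.{u} L) where
  /-- interpretation of sorts -/
  srt : Sg.Srt → A.Obj
  /-- interpretation of function symbols -/
  fn : ∀ {as : List Sg.Srt} {τ : Sg.Srt}, Sg.Fn as τ → (ctxObj A srt as ⟶ srt τ)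
  /-- interpretation of relation symbols -/
  rel : ∀ {as : List Sg.Srt}, Sg.Rel as → A.Pred (ctxObj A srt as)

namespace Str

variable {A : PropCat.{u} L}

/-- The object interpreting a context. -/
def ctx (S : Str Sg A) (Γ : List Sg.Srt) : A.Obj := ctxObj A S.srt Γ

/-- The projection interpreting a variable. -/
def proj (S : Str Sg A) : ∀ {Γ : List Sg.Srt} {σ : Sg.Srt}, Var Γ σ → (S.ctx Γ ⟶ S.srt σ)
  | σ :: Γ, _, .zero => snd (S.ctx Γ) (S.srt σ)
  | σ :: Γ, _, .succ v => fst (S.ctx Γ) (S.srt σ) ≫ S.proj v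

/-- The morphism into the interpretation of a context with given components. -/
def tuple (S : Str Sg A) {X : A.Obj} :
    ∀ {Δ : List Sg.Srt}, (∀ σ : Sg.Srt, Var Δ σ → (X ⟶ S.srt σ)) → (X ⟶ S.ctx Δ)
  | [], _ => toUnit X
  | _ :: _, g => lift (S.tuple (fun σ v => g σ v.succ)) (g _ .zero)

/-- The interpretation of a term in context. -/
def term (S : Str Sg A) {Γ : List Sg.Srt} : ∀ {σ : Sg.Srt}, Term Sg Γ σ → (S.ctx Γ ⟶ S.srt σ)
  | _, .var v => S.proj v
  | _, .app f args => S.tuple (fun σ v => S.term (args σ v)) ≫ S.fn f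

/-- The interpretation of a formula in context. -/
def formula (S : Str Sg A) : ∀ {Γ : List Sg.Srt}, Formula L Sg Γ → A.Pred (S.ctx Γ)
  | _, .rel R args => A.reindex (S.tuple (fun σ v => S.term (args σ v))) (S.rel R)
  | _, .eq (τ := τ) M N => A.reindex (lift (S.term M) (S.term N)) (A.eqPred (S.srt τ))
  | Γ, .conn k φ => A.conn k (S.ctx Γ) (fun i => S.formula (φ i))
  | Γ, .quant q σ φ => A.quant q (S.ctx Γ) (S.srt σ) (S.formula φ)

/-- Satisfaction of an assertion in a structure. -/
def Satisfies (S : Str Sg A) : Assertion L Sg → Prop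
  | .eqn M N => S.term M = S.term N
  | .seq Φ ψ => A.tensAll (Φ.map S.formula) ≤ S.formula ψ

/-- The theory of a structure. -/
def theory (S : Str Sg A) : Theory L Sg := {a | S.Satisfies a}

/-- `S` is a `T`-model. -/
def IsModel (S : Str Sg A) (T : Theory L Sg) : Prop := T ≤ S.theory

end Str

/-- `T ⊨ T'` over a class `X` of prop-categories: every `T`-model in a member of `X` is a
`T'`-model. -/
def Entails (X : Set (PropCat.{u} L)) (Sg : Signature.{u}) (T T' : Theory L Sg) : Prop :=
  ∀ A ∈ X, ∀ S : Str Sg A, S.IsModel T → S.IsModel T'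

/-- The logic `⊨` of a class `X` of prop-categories: the closure of an `Sg`-theory `T` consists of
the assertions satisfied by all `T`-models in members of `X`. -/
def semanticLogic (X : Set (PropCat.{u} L)) : Logic L := fun Sg =>
  ClosureOperator.mk' (fun T => {a | ∀ A ∈ X, ∀ S : Str Sg A, S.IsModel T → S.Satisfies a})
    (fun _ _ h _ ha A hA S hS => ha A hA S (le_trans h hS))
    (fun _ _ ha _ _ _ hS => hS ha)
    (fun _ _ ha A hA S hS => ha A hA S (fun _ hb => hb A hA S hS))

theorem semanticLogic_derives_iff (X : Set (PropCat.{u} L)) (Sg : Signature.{u})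
    (T T' : Theory L Sg) : (semanticLogic X).Derives Sg T T' ↔ Entails X Sg T T' :=
  ⟨fun h A hA S hS _ ha => h ha A hA S hS, fun h _ ha A hA S hS => h A hA S hS ha⟩

/-- The class of prop-categories for which the logic `K` is sound. -/
def soundClass (K : Logic L) : Set (PropCat.{u} L) :=
  {A | ∀ (Sg : Signature.{u}) (T T' : Theory L Sg), K.Derives Sg T T' → Entails {A} Sg T T'}

/-! ### Products of prop-categories -/

theorem map_pair {α β : Type u} (f : α → β) (a b : α) :
    (fun j => f (![a, b] j)) = ![f a, f b] := by
  funext j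
  fin_cases j <;> rfl

theorem map_empty {α β : Type u} (f : α → β) : (fun j => f ((![] : Fin 0 → α) j)) = ![] :=
  funext fun j => j.elim0

/-- Designated finite products from a terminal object and binary products. -/
abbrev chosenProducts {C : Type u} [Category.{u} C] (one : C) (toOne : ∀ c : C, c ⟶ one)
    (toOne_unique : ∀ {c : C} (f g : c ⟶ one), f = g)
    (prod : C → C → C) (p : ∀ c d : C, prod c d ⟶ c) (q : ∀ c d : C, prod c d ⟶ d)
    (pair : ∀ {b c d : C}, (b ⟶ c) → (b ⟶ d) → (b ⟶ prod c d))
    (pair_p : ∀ {b c d : C} (f : b ⟶ c) (g : b ⟶ d), pair f g ≫ p c d = f)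
    (pair_q : ∀ {b c d : C} (f : b ⟶ c) (g : b ⟶ d), pair f g ≫ q c d = g)
    (hom_ext : ∀ {b c d : C} (f g : b ⟶ prod c d),
      f ≫ p c d = g ≫ p c d → f ≫ q c d = g ≫ q c d → f = g) :
    CartesianMonoidalCategory C :=
  .ofChosenFiniteProducts
    ⟨asEmptyCone one, IsTerminal.ofUniqueHom toOne (fun _ f => toOne_unique f _)⟩
    (fun c d => ⟨BinaryFan.mk (p c d) (q c d), BinaryFan.IsLimit.mk _ (fun f g => pair f g)
      (fun f g => pair_p f g) (fun f g => pair_q f g)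
      (fun f g _ h1 h2 => hom_ext _ _ (h1.trans (pair_p f g).symm) (h2.trans (pair_q f g).symm))⟩)

namespace PropCat

instance piProducts {I : Type u} (C : I → Type u) [∀ i, Category.{u} (C i)]
    [∀ i, CartesianMonoidalCategory (C i)] : CartesianMonoidalCategory (∀ i, C i) where
  toMonoidalCategory := Pi.monoidalCategory (C := C)
  isTerminalTensorUnit := IsTerminal.ofUniqueHom (fun c i => toUnit (c i))
    (fun _ f => funext fun i => toUnit_unique (f i) _)
  fst c d := fun i => fst (c i) (d i)
  snd c d := fun i => snd (c i) (d i)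
  tensorProductIsBinaryProduct c d := BinaryFan.IsLimit.mk _ (fun f g i => lift (f i) (g i))
    (fun f g => funext fun i => lift_fst (f i) (g i))
    (fun f g => funext fun i => lift_snd (f i) (g i))
    (fun f g m h1 h2 => funext fun i => CartesianMonoidalCategory.hom_ext (m i) _
      ((congrFun h1 i).trans (lift_fst (f i) (g i)).symm)
      ((congrFun h2 i).trans (lift_snd (f i) (g i)).symm))
  fst_def c d := funext fun i => by
    rw [fst_def]
    exact congrArg (fun f => c i ◁ f ≫ (ρ_ (c i)).hom) (toUnit_unique _ _)
  snd_def c d := funext fun i => by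
    rw [snd_def]
    exact congrArg (fun f => f ▷ d i ≫ (λ_ (d i)).hom) (toUnit_unique _ _)

/-- The product of a family of prop-categories, with componentwise structure. For the empty family
it is the terminal prop-category. -/
def pi {I : Type u} (A : I → PropCat.{u} L) : PropCat.{u} L where
  Obj := ∀ i, (A i).Obj
  cat := CategoryTheory.pi _
  prods := piProducts _
  Pred c := ∀ i, (A i).Pred (c i)
  ord _ := Pi.partialOrder
  reindex f :=
    ⟨fun r i => (A i).reindex (f i) (r i), fun _ _ h i => ((A i).reindex (f i)).monotone (h i)⟩
  reindex_id r := funext fun i => (A i).reindex_id (r i)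
  reindex_comp f g r := funext fun i => (A i).reindex_comp (f i) (g i) (r i)
  conn k c r := fun i => (A i).conn k (c i) (fun j => r j i)
  reindex_conn k _ _ f r := funext fun i => (A i).reindex_conn k (f i) (fun j => r j i)
  eqPred c := fun i => (A i).eqPred (c i)
  quant q b c r := fun i => (A i).quant q (b i) (c i) (r i)
  quant_natural q b b' f c r := funext fun i => (A i).quant_natural q (f i) (c i) (r i)
  tensor_assoc c r s t := funext fun i => by
    have h := (A i).tensor_assoc (c i) (r i) (s i) (t i)
    simp only [map_pair (fun x : ∀ i, (A i).Pred (c i) => x i)]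
    exact h
  unit_tensor c r := funext fun i => by
    have h := (A i).unit_tensor (c i) (r i)
    simp only [map_pair (fun x : ∀ i, (A i).Pred (c i) => x i),
      map_empty (fun x : ∀ i, (A i).Pred (c i) => x i)]
    exact h
  tensor_unit c r := funext fun i => by
    have h := (A i).tensor_unit (c i) (r i)
    simp only [map_pair (fun x : ∀ i, (A i).Pred (c i) => x i),
      map_empty (fun x : ∀ i, (A i).Pred (c i) => x i)]
    exact h
  quant_one q b r := funext fun i => (A i).quant_one q (b i) (r i)
  quant_prod q b c d r := funext fun i => (A i).quant_prod q (b i) (c i) (d i) (r i)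
  eqPred_one := funext fun i => by
    refine (A i).eqPred_one.trans (congrArg _ ?_)
    exact funext fun j => j.elim0
  eqPred_prod c₁ c₂ := funext fun i => by
    refine ((A i).eqPred_prod (c₁ i) (c₂ i)).trans (congrArg _ ?_)
    funext j
    fin_cases j <;> rfl

end PropCat

/-! ### The classifying prop-category of a theory -/

/-- The objects of the base category of the classifying prop-category are contexts. -/
structure MinimalTheory.Ctx (T : MinimalTheory L Sg) where
  /-- the list of sorts -/
  ctx : List Sg.Srt

namespace MinimalTheory

variable (T : MinimalTheory L Sg)

/-- Equality of lists of terms modulo the theory. -/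
def substSetoid (Γ Δ : List Sg.Srt) : Setoid (Subst Sg Γ Δ) where
  r γ γ' := ∀ (σ : Sg.Srt) (v : Var Δ σ), .eqn (γ σ v) (γ' σ v) ∈ T.carrier
  iseqv := ⟨fun _ _ _ => T.eq_refl _, fun h σ v => T.eq_symm (h σ v),
    fun h h' σ v => T.eq_trans (h σ v) (h' σ v)⟩

/-- Interderivability of formulas in context modulo the theory. -/
def formulaSetoid (Γ : List Sg.Srt) : Setoid (Formula L Sg Γ) where
  r φ ψ := .seq [φ] ψ ∈ T.carrier ∧ .seq [ψ] φ ∈ T.carrier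
  iseqv := ⟨fun φ => ⟨T.ax φ, T.ax φ⟩, fun h => ⟨h.2, h.1⟩,
    fun h h' => ⟨T.cut h.1 h'.1, T.cut h'.2 h.2⟩⟩

/-- Morphisms of contexts are lists of terms modulo the theory, and composition is componentwise
substitution. -/
instance : Category.{u} T.Ctx where
  Hom Γ Δ := Quotient (T.substSetoid Γ.ctx Δ.ctx)
  id Γ := Quotient.mk (T.substSetoid Γ.ctx Γ.ctx) (Subst.id Γ.ctx)
  comp {Γ Δ Θ} f g := Quotient.map₂ (sa := T.substSetoid Γ.ctx Δ.ctx)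
    (sb := T.substSetoid Δ.ctx Θ.ctx) (sc := T.substSetoid Γ.ctx Θ.ctx) Subst.comp
    (fun _ _ h _ _ h' σ v => T.eq_sub h (h' σ v)) f g
  id_comp f := by
    induction f using Quotient.inductionOn with
    | h γ => exact congrArg (Quotient.mk _) (Subst.id_comp γ)
  comp_id f := by
    induction f using Quotient.inductionOn with
    | h γ => exact congrArg (Quotient.mk _) (Subst.comp_id γ)
  assoc f g h := by
    induction f using Quotient.inductionOn with
    | h γ =>
      induction g using Quotient.inductionOn with
      | h δ =>
        induction h using Quotient.inductionOn with
        | h θ => exact congrArg (Quotient.mk _) (Subst.comp_assoc γ δ θ)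

/-- The morphism of contexts given by a list of terms. -/
def hom {Γ Δ : T.Ctx} (γ : Subst Sg Γ.ctx Δ.ctx) : Γ ⟶ Δ :=
  Quotient.mk (T.substSetoid Γ.ctx Δ.ctx) γ

theorem hom_ind {Γ Δ : T.Ctx} {p : (Γ ⟶ Δ) → Prop}
    (h : ∀ γ : Subst Sg Γ.ctx Δ.ctx, p (T.hom γ)) (f : Γ ⟶ Δ) : p f := Quotient.ind h f

theorem hom_comp {Γ Δ Θ : T.Ctx} (γ : Subst Sg Γ.ctx Δ.ctx) (δ : Subst Sg Δ.ctx Θ.ctx) :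
    (T.hom γ : Γ ⟶ Δ) ≫ (T.hom δ : Δ ⟶ Θ) = T.hom (γ.comp δ) := rfl

theorem hom_eq_iff {Γ Δ : T.Ctx} {γ γ' : Subst Sg Γ.ctx Δ.ctx} :
    (T.hom γ : Γ ⟶ Δ) = T.hom γ' ↔
      ∀ (σ : Sg.Srt) (v : Var Δ.ctx σ), .eqn (γ σ v) (γ' σ v) ∈ T.carrier :=
  ⟨fun h => Quotient.exact (s := T.substSetoid Γ.ctx Δ.ctx) h,
    fun h => Quotient.sound (s := T.substSetoid Γ.ctx Δ.ctx) h⟩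

theorem append_rel {Θ Γ Δ : List Sg.Srt} {γ γ' : Subst Sg Θ (Δ ++ Γ)}
    (hf : T.substSetoid Θ Γ (γ.comp (Subst.fst Γ Δ)) (γ'.comp (Subst.fst Γ Δ)))
    (hs : T.substSetoid Θ Δ (γ.comp (Subst.snd Γ Δ)) (γ'.comp (Subst.snd Γ Δ))) :
    T.substSetoid Θ (Δ ++ Γ) γ γ' :=
  Subst.append_ext_rel
    (r := fun σ (M N : Term Sg Θ σ) => (.eqn M N : Assertion L Sg) ∈ T.carrier) hf hs

/-- The designated product of `Γ` and `Δ` is the context `Γ` followed by `Δ`. -/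
instance : CartesianMonoidalCategory T.Ctx :=
  chosenProducts (C := T.Ctx) ⟨[]⟩ (fun _ => T.hom (fun _ v => nomatch v))
    (fun {Γ} => T.hom_ind fun γ => T.hom_ind fun δ => congrArg T.hom (Subst.ext_nil γ δ))
    (fun Γ Δ => ⟨Δ.ctx ++ Γ.ctx⟩)
    (fun Γ Δ => T.hom (Subst.fst Γ.ctx Δ.ctx)) (fun Γ Δ => T.hom (Subst.snd Γ.ctx Δ.ctx))
    (fun {Θ Γ Δ} f g => Quotient.map₂ (sa := T.substSetoid Θ.ctx Γ.ctx)
      (sb := T.substSetoid Θ.ctx Δ.ctx) (sc := T.substSetoid Θ.ctx (Δ.ctx ++ Γ.ctx))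
      (fun γ δ => Subst.append γ δ)
      (fun γ γ' h δ δ' h' => T.append_rel
        (by rwa [Subst.append_fst, Subst.append_fst])
        (by rwa [Subst.append_snd, Subst.append_snd])) f g)
    (fun {Θ Γ Δ} f g => by
      induction f using T.hom_ind with
      | h γ =>
        induction g using T.hom_ind with
        | h δ => exact congrArg (fun ε => (T.hom ε : Θ ⟶ Γ)) (Subst.append_fst γ δ))
    (fun {Θ Γ Δ} f g => by
      induction f using T.hom_ind with
      | h γ =>
        induction g using T.hom_ind with
        | h δ => exact congrArg (fun ε => (T.hom ε : Θ ⟶ Δ)) (Subst.append_snd γ δ))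
    (fun {Θ Γ Δ} => T.hom_ind fun γ => T.hom_ind fun δ => fun h1 h2 =>
      T.hom_eq_iff.2 (T.append_rel (T.hom_eq_iff.1 h1) (T.hom_eq_iff.1 h2)))

theorem fst_hom (Γ Δ : T.Ctx) : fst Γ Δ = T.hom (Subst.fst Γ.ctx Δ.ctx) := rfl

theorem snd_hom (Γ Δ : T.Ctx) : snd Γ Δ = T.hom (Subst.snd Γ.ctx Δ.ctx) := rfl

theorem lift_hom {Θ Γ Δ : T.Ctx} (γ : Subst Sg Θ.ctx Γ.ctx) (δ : Subst Sg Θ.ctx Δ.ctx) :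
    lift (T.hom γ : Θ ⟶ Γ) (T.hom δ : Θ ⟶ Δ) =
      (T.hom (Subst.append γ δ) : Θ ⟶ Γ ⊗ Δ) := by
  apply CartesianMonoidalCategory.hom_ext
  · rw [lift_fst]
    exact (congrArg (fun ε => (T.hom ε : Θ ⟶ Γ)) (Subst.append_fst γ δ)).symm
  · rw [lift_snd]
    exact (congrArg (fun ε => (T.hom ε : Θ ⟶ Δ)) (Subst.append_snd γ δ)).symm

theorem whiskerRight_hom {Γ Γ' : T.Ctx} (γ : Subst Sg Γ.ctx Γ'.ctx) (Δ : T.Ctx) :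
    (T.hom γ : Γ ⟶ Γ') ▷ Δ =
      (T.hom (Subst.append ((Subst.fst Γ.ctx Δ.ctx).comp γ) (Subst.snd Γ.ctx Δ.ctx)) :
        Γ ⊗ Δ ⟶ Γ' ⊗ Δ) := by
  refine Eq.trans ?_ (T.lift_hom (Θ := Γ ⊗ Δ) (Γ := Γ') (Δ := Δ)
    ((Subst.fst Γ.ctx Δ.ctx).comp γ) (Subst.snd Γ.ctx Δ.ctx))
  apply CartesianMonoidalCategory.hom_ext
  · rw [lift_fst, whiskerRight_fst]
    rfl
  · rw [lift_snd, whiskerRight_snd]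
    rfl

theorem associator_inv_hom (Γ Δ Θ : T.Ctx) :
    (α_ Γ Δ Θ).inv = (T.hom (Subst.assocInv Γ.ctx Δ.ctx Θ.ctx) : Γ ⊗ (Δ ⊗ Θ) ⟶ (Γ ⊗ Δ) ⊗ Θ) := by
  have h : (α_ Γ Δ Θ).inv =
      lift (lift (fst Γ (Δ ⊗ Θ)) (snd Γ (Δ ⊗ Θ) ≫ fst Δ Θ)) (snd Γ (Δ ⊗ Θ) ≫ snd Δ Θ) := by
    apply CartesianMonoidalCategory.hom_ext
    · apply CartesianMonoidalCategory.hom_ext <;> simp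
    · simp
  rw [h]
  exact (congrArg (fun f => lift f _)
    (T.lift_hom (Θ := Γ ⊗ (Δ ⊗ Θ)) (Γ := Γ) (Δ := Δ) _ _)).trans
    (T.lift_hom (Θ := Γ ⊗ (Δ ⊗ Θ)) (Γ := Γ ⊗ Δ) (Δ := Θ) _ _)

/-- The poset over a context: formulas modulo interderivability, ordered by derivability. -/
def Pred (Γ : T.Ctx) : Type u := Quotient (T.formulaSetoid Γ.ctx)

/-- The class of a formula. -/
def cls (Γ : T.Ctx) (φ : Formula L Sg Γ.ctx) : T.Pred Γ :=
  Quotient.mk (T.formulaSetoid Γ.ctx) φ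

theorem cls_eq_iff {Γ : T.Ctx} {φ ψ : Formula L Sg Γ.ctx} :
    T.cls Γ φ = T.cls Γ ψ ↔ .seq [φ] ψ ∈ T.carrier ∧ .seq [ψ] φ ∈ T.carrier :=
  ⟨fun h => Quotient.exact (s := T.formulaSetoid Γ.ctx) h,
    fun h => Quotient.sound (s := T.formulaSetoid Γ.ctx) h⟩

theorem cls_eq_of {Γ : T.Ctx} {φ ψ : Formula L Sg Γ.ctx}
    (h : ∀ θ : Formula L Sg Γ.ctx, .seq [φ] θ ∈ T.carrier ↔ .seq [ψ] θ ∈ T.carrier) :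
    T.cls Γ φ = T.cls Γ ψ :=
  T.cls_eq_iff.2 ⟨(h ψ).2 (T.ax ψ), (h φ).1 (T.ax φ)⟩

theorem cls_ind {Γ : T.Ctx} {p : T.Pred Γ → Prop} (h : ∀ φ, p (T.cls Γ φ)) (r : T.Pred Γ) :
    p r := Quotient.ind h r

instance (Γ : T.Ctx) : PartialOrder (T.Pred Γ) where
  le := Quotient.lift₂ (s₁ := T.formulaSetoid Γ.ctx) (s₂ := T.formulaSetoid Γ.ctx)
    (fun (φ ψ : Formula L Sg Γ.ctx) => Assertion.seq [φ] ψ ∈ T.carrier)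
    (fun _ _ _ _ h h' => propext
      ⟨fun k => T.cut h.2 (T.cut k h'.1), fun k => T.cut h.1 (T.cut k h'.2)⟩)
  le_refl := T.cls_ind fun φ => T.ax φ
  le_trans := T.cls_ind fun _ => T.cls_ind fun _ => T.cls_ind fun _ h h' => T.cut h h'
  le_antisymm := T.cls_ind fun _ => T.cls_ind fun _ h h' => T.cls_eq_iff.2 ⟨h, h'⟩

theorem cls_le_iff {Γ : T.Ctx} {φ ψ : Formula L Sg Γ.ctx} :
    T.cls Γ φ ≤ T.cls Γ ψ ↔ .seq [φ] ψ ∈ T.carrier := Iff.rfl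

/-- Simultaneous substitution modulo the theory. -/
def reindex {Γ Δ : T.Ctx} (f : Γ ⟶ Δ) : T.Pred Δ →o T.Pred Γ where
  toFun := Quotient.map₂ (sa := T.substSetoid Γ.ctx Δ.ctx) (sb := T.formulaSetoid Δ.ctx)
    (sc := T.formulaSetoid Γ.ctx) Formula.subst
    (fun _ _ h _ _ h' => ⟨T.sub h h'.1, T.sub ((T.substSetoid Γ.ctx Δ.ctx).symm h) h'.2⟩) f
  monotone' := by
    induction f using T.hom_ind with
    | h γ => exact T.cls_ind fun _ => T.cls_ind fun _ h => T.sub (fun _ _ => T.eq_refl _) h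

theorem reindex_cls {Γ Δ : T.Ctx} (γ : Subst Sg Γ.ctx Δ.ctx) (φ : Formula L Sg Δ.ctx) :
    T.reindex (T.hom γ) (T.cls Δ φ) = T.cls Γ (φ.subst γ) := rfl

/-- The operations on formulas modulo the theory given by the connectives. -/
def conn {n : ℕ} (k : L.Conn n) (Γ : T.Ctx) (r : Fin n → T.Pred Γ) : T.Pred Γ :=
  T.cls Γ (.conn k (fun i => @Quotient.out _ (T.formulaSetoid Γ.ctx) (r i)))

theorem conn_cls {n : ℕ} (k : L.Conn n) {Γ : T.Ctx} (φ : Fin n → Formula L Sg Γ.ctx) :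
    T.conn k Γ (fun i => T.cls Γ (φ i)) = T.cls Γ (.conn k φ) := by
  have h := fun i => @Quotient.mk_out _ (T.formulaSetoid Γ.ctx) (φ i)
  exact T.cls_eq_iff.2 ⟨T.conn_cong k (fun i => (h i).1) (fun i => (h i).2),
    T.conn_cong k (fun i => (h i).2) (fun i => (h i).1)⟩

theorem conn_ind {n : ℕ} {Γ : T.Ctx} {p : (Fin n → T.Pred Γ) → Prop}
    (h : ∀ φ : Fin n → Formula L Sg Γ.ctx, p (fun i => T.cls Γ (φ i)))
    (r : Fin n → T.Pred Γ) : p r := by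
  have := h (fun i => @Quotient.out _ (T.formulaSetoid Γ.ctx) (r i))
  have e : (fun i => T.cls Γ (@Quotient.out _ (T.formulaSetoid Γ.ctx) (r i))) = r :=
    funext fun i => @Quotient.out_eq _ (T.formulaSetoid Γ.ctx) (r i)
  rwa [e] at this

theorem conn_tensor_cls {Γ : T.Ctx} (φ ψ : Formula L Sg Γ.ctx) :
    T.conn L.tensor Γ ![T.cls Γ φ, T.cls Γ ψ] = T.cls Γ (.tens φ ψ) := by
  rw [← map_pair (T.cls Γ), conn_cls]
  rfl

theorem conn_unit_cls (Γ : T.Ctx) : T.conn L.unit Γ ![] = T.cls Γ (.unit Γ.ctx) := by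
  rw [← map_empty (T.cls Γ), conn_cls]
  rfl

theorem cls_tens_assoc {Γ : T.Ctx} (α β γ : Formula L Sg Γ.ctx) :
    T.cls Γ (.tens (.tens α β) γ) = T.cls Γ (.tens α (.tens β γ)) :=
  T.cls_eq_of fun θ => ((T.tensor_ref [] [] (.tens α β) γ θ).symm.trans
    ((T.tensor_ref [] [γ] α β θ).symm.trans (T.tensor_ref [α] [] β γ θ))).trans
      (T.tensor_ref [] [] α (.tens β γ) θ)

theorem cls_unit_tens {Γ : T.Ctx} (α : Formula L Sg Γ.ctx) :
    T.cls Γ (.tens (.unit Γ.ctx) α) = T.cls Γ α :=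
  T.cls_eq_of fun θ =>
    (T.tensor_ref [] [] (.unit Γ.ctx) α θ).symm.trans (T.unit_ref [] [α] θ)

theorem cls_tens_unit {Γ : T.Ctx} (α : Formula L Sg Γ.ctx) :
    T.cls Γ (.tens α (.unit Γ.ctx)) = T.cls Γ α :=
  T.cls_eq_of fun θ =>
    (T.tensor_ref [] [] α (.unit Γ.ctx) θ).symm.trans (T.unit_ref [α] [] θ)

theorem cls_tens_congr {Γ : T.Ctx} {α α' β β' : Formula L Sg Γ.ctx}
    (h : T.cls Γ α = T.cls Γ α') (h' : T.cls Γ β = T.cls Γ β') :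
    T.cls Γ (.tens α β) = T.cls Γ (.tens α' β') := by
  rw [← conn_tensor_cls, ← conn_tensor_cls, h, h']

theorem quantAll_congr (q : L.Quant) {Γ : List Sg.Srt} :
    ∀ (Δ : List Sg.Srt) (φ ψ : Formula L Sg (Δ ++ Γ)),
      .seq [φ] ψ ∈ T.carrier → .seq [ψ] φ ∈ T.carrier →
        (T.formulaSetoid Γ).r (.quantAll q Δ φ) (.quantAll q Δ ψ)
  | [], _, _, h, h' => ⟨h, h'⟩
  | _ :: Δ, _, _, h, h' => quantAll_congr q Δ _ _ (T.quant_con q h h') (T.quant_con q h' h)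

/-- The quantifier maps: quantification over all variables of a context. -/
def quant (q : L.Quant) (Γ Δ : T.Ctx) (r : T.Pred (Γ ⊗ Δ)) : T.Pred Γ :=
  Quotient.map (sa := T.formulaSetoid (Δ.ctx ++ Γ.ctx)) (sb := T.formulaSetoid Γ.ctx)
    (fun φ => Formula.quantAll q Δ.ctx φ)
    (fun φ ψ h => T.quantAll_congr q Δ.ctx φ ψ h.1 h.2) r

theorem quant_cls (q : L.Quant) (Γ Δ : T.Ctx) (φ : Formula L Sg (Δ.ctx ++ Γ.ctx)) :
    T.quant q Γ Δ (T.cls (Γ ⊗ Δ) φ) = T.cls Γ (.quantAll q Δ.ctx φ) := rfl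

/-- The equality predicate `x₁ = x₁' ⊗ … ⊗ xₙ = xₙ'` on a context. -/
def eqPred (Γ : T.Ctx) : T.Pred (Γ ⊗ Γ) :=
  T.cls (Γ ⊗ Γ) (.eqAll (Subst.fst Γ.ctx Γ.ctx) (Subst.snd Γ.ctx Γ.ctx))

theorem cls_eqAll_append {Θ : T.Ctx} {Γ : List Sg.Srt} :
    ∀ {Δ : List Sg.Srt} (γ δ : Subst Sg Θ.ctx (Δ ++ Γ)),
      T.cls Θ (.eqAll γ δ) =
        T.cls Θ (.tens (.eqAll (γ.comp (Subst.fst Γ Δ)) (δ.comp (Subst.fst Γ Δ)))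
          (.eqAll (γ.comp (Subst.snd Γ Δ)) (δ.comp (Subst.snd Γ Δ))))
  | [], _, _ => (T.cls_tens_unit _).symm
  | σ :: Δ, γ, δ => by
    have h := cls_eqAll_append (Δ := Δ) (fun σ v => γ σ v.succ) (fun σ v => δ σ v.succ)
    refine (T.cls_tens_congr h rfl).trans ((T.cls_tens_assoc _ _ _).trans ?_)
    have e1 : ∀ ε : Subst Sg Θ.ctx (σ :: (Δ ++ Γ)), ε.comp (Subst.fst Γ (σ :: Δ)) =
        Subst.comp (fun σ v => ε σ v.succ) (Subst.fst Γ Δ) := fun ε =>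
      (Subst.comp_assoc ε (Subst.wk (Δ ++ Γ) σ) (Subst.fst Γ Δ)).symm
    have e2 : ∀ ε : Subst Sg Θ.ctx (σ :: (Δ ++ Γ)),
        (fun τ v => (ε.comp (Subst.snd Γ (σ :: Δ))) τ (Var.succ v)) =
          Subst.comp (fun σ v => ε σ v.succ) (Subst.snd Γ Δ) := fun ε =>
      (Subst.comp_assoc ε (Subst.wk (Δ ++ Γ) σ) (Subst.snd Γ Δ)).symm
    have e3 : ∀ γ' δ' : Subst Sg Θ.ctx (σ :: Δ), Formula.eqAll (L := L) γ' δ' =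
      .tens (.eqAll (fun τ v => γ' τ (Var.succ v)) (fun τ v => δ' τ (Var.succ v)))
        (.eq (γ' _ .zero) (δ' _ .zero)) := fun _ _ => rfl
    refine congrArg (T.cls Θ) ?_
    rw [e3]
    exact (congrArg₂ Formula.tens (congrArg₂ Formula.eqAll (e1 γ) (e1 δ))
      (congrArg₂ Formula.tens (congrArg₂ Formula.eqAll (e2 γ) (e2 δ)) rfl)).symm

/-- The classifying prop-category of a theory. -/
def classifying : PropCat.{u} L where
  Obj := T.Ctx
  Pred := T.Pred
  reindex := T.reindex
  reindex_id {Γ} := T.cls_ind (fun φ => congrArg (T.cls Γ) φ.subst_id)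
  reindex_comp {Γ Δ Θ} f g := T.cls_ind (fun φ => by
    induction f using T.hom_ind with
    | h γ =>
      induction g using T.hom_ind with
      | h δ => exact congrArg (T.cls Γ) (Formula.subst_subst γ δ φ).symm)
  conn := T.conn
  reindex_conn k Γ _ f := T.conn_ind (fun φ => by
    induction f using T.hom_ind with
    | h γ =>
      rw [conn_cls]
      exact (T.conn_cls k (fun i => (φ i).subst γ)).symm)
  eqPred := T.eqPred
  quant := T.quant
  quant_natural q {Γ _} f Δ := T.cls_ind (fun φ => by
    induction f using T.hom_ind with
    | h γ =>
      rw [whiskerRight_hom]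
      exact congrArg (T.cls Γ) (Formula.quantAll_subst q γ Δ.ctx φ).symm)
  tensor_assoc Γ := T.cls_ind fun φ => T.cls_ind fun ψ => T.cls_ind fun θ => by
    rw [conn_tensor_cls, conn_tensor_cls, conn_tensor_cls, conn_tensor_cls, cls_tens_assoc]
  unit_tensor Γ := T.cls_ind fun φ => by
    rw [conn_unit_cls, conn_tensor_cls, cls_unit_tens]
  tensor_unit Γ := T.cls_ind fun φ => by
    rw [conn_unit_cls, conn_tensor_cls, cls_tens_unit]
  quant_one q Γ := T.cls_ind fun φ => congrArg (T.cls Γ) φ.subst_id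
  quant_prod q Γ Δ Θ := T.cls_ind fun φ => by
    rw [associator_inv_hom]
    exact congrArg (T.cls Γ) (Formula.quantAll_append q Θ.ctx φ)
  eqPred_one := (T.conn_unit_cls _).symm
  eqPred_prod Γ Δ := by
    have hf : ∀ {Θ Ξ : T.Ctx} (γ δ : Subst Sg Θ.ctx Ξ.ctx),
        T.reindex (lift (T.hom γ : Θ ⟶ Ξ) (T.hom δ : Θ ⟶ Ξ)) (T.eqPred Ξ) =
          T.cls Θ (.eqAll γ δ) := fun {Θ Ξ} γ δ => by
      rw [lift_hom]
      refine congrArg (T.cls Θ) ((Formula.eqAll_subst _ _ _).trans ?_)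
      rw [Subst.append_fst, Subst.append_snd]
    refine (T.cls_eqAll_append (Θ := (Γ ⊗ Δ) ⊗ (Γ ⊗ Δ)) (Γ := Γ.ctx) (Δ := Δ.ctx) _ _).trans ?_
    refine (T.conn_tensor_cls _ _).symm.trans (congrArg _ ?_)
    exact congrArg₂ (fun r s => ![r, s]) (hf (Θ := (Γ ⊗ Δ) ⊗ (Γ ⊗ Δ)) (Ξ := Γ) _ _).symm
      (hf (Θ := (Γ ⊗ Δ) ⊗ (Γ ⊗ Δ)) (Ξ := Δ) _ _).symm

end MinimalTheory

/-! ### Operations on classes of prop-categories -/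

/-- The closure of a class under products of small families. -/
inductive ProdClosure (X : Set (PropCat.{u} L)) : Set (PropCat.{u} L)
  | base (A : PropCat.{u} L) (h : A ∈ X) : ProdClosure X A
  | prod {I : Type u} (A : I → PropCat.{u} L) (h : ∀ i, ProdClosure X (A i)) :
      ProdClosure X (PropCat.pi A)

/-- The closure of a class under subprop-categories. -/
inductive SubClosure (X : Set (PropCat.{u} L)) : Set (PropCat.{u} L)
  | base (A : PropCat.{u} L) (h : A ∈ X) : SubClosure X A
  | sub {A B : PropCat.{u} L} (h : SubClosure X A) (hB : B.IsSubpropCategory A) : SubClosure X B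

/-- The class of prop-categories all of whose classifying subprop-categories belong to `X`. -/
def classifyingClosure (X : Set (PropCat.{u} L)) : Set (PropCat.{u} L) :=
  {A | ∀ (Sg : Signature.{u}) (T : MinimalTheory L Sg),
    T.classifying.IsSubpropCategory A → T.classifying ∈ X}

end

end FiberedLogic

/-!
The proof links three facts about structures and morphisms of prop-categories.

* A morphism `F : A ⟶ B` carries a structure `S` in `A` to a structure `F.mapStr S` in `B` whose
  interpretations are the images of those of `S`, up to the comparison isomorphisms between products
  (`Hom.map_term`, `Hom.app_formula`). Hence satisfaction is preserved, and it is reflected by a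
  family of morphisms that is jointly faithful and jointly reflects the order
  (`Hom.JointlyConservative.satisfies`). Both the projections from a product and the inclusion of a
  subprop-category are such families, so `SubClosure (ProdClosure X)` consists of prop-categories
  that are sound for `⊨_X`.
* A model of a theory `T` in `A` is a morphism from the classifying prop-category of `T` to `A`
  (`MinimalTheory.modelHom`); a family of models is jointly conservative if it refutes every
  assertion outside `T`. The theory of a structure is closed under the rules of the minimal logic
  (`Str.minimalTheory`), so the classifying prop-category of the theory of a structure in `A` is a
  subprop-category of `A`.
* The classifying prop-category of `T` contains a generic model, which satisfies exactly the
  assertions in `T` (`MinimalTheory.generic_satisfies_iff`).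

If `A` is sound for `⊨_X` and the classifying prop-category of `T` is a subprop-category of `A`,
then it is sound too, so by way of the generic model every assertion outside `T` is refuted by a
model of `T` in some member of `X`. All these models together embed the classifying prop-category
into a product of members of `X` (`classifying_mem_subClosure`). Conversely, if every classifying
subprop-category of `A` belongs to `SubClosure (ProdClosure X)`, then a structure `S` in `A` has the
same theory as the generic model of its own theory, which lives in a prop-category that is sound for
`⊨_X`. This gives the equality of classes. That the class of sound prop-categories is the largest
one with the logic `⊨_X` is the Galois connection between classes and logics.
-/

namespace FiberedLogic

open CategoryTheory MonoidalCategory CartesianMonoidalCategory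

noncomputable section

variable {L : FOLanguage.{u}} {Sg : Signature.{u}}

/-! ### Interpretation of substitution -/

namespace Str

variable {A : PropCat.{u} L} (S : Str Sg A)

/-- The existence half of the universal property that makes the interpretation of a context the
product of the interpretations of its sorts; `ctx_hom_ext` is the uniqueness half. -/
theorem tuple_proj {X : A.Obj} : ∀ {Δ : List Sg.Srt} (g : ∀ σ : Sg.Srt, Var Δ σ → (X ⟶ S.srt σ))
    {σ : Sg.Srt} (v : Var Δ σ), S.tuple g ≫ S.proj v = g σ v
  | _ :: _, g, _, .zero => lift_snd _ _
  | _ :: _, g, _, .succ v => by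
    refine Eq.trans ?_ (tuple_proj (fun σ v => g σ (Var.succ v)) v)
    exact (Category.assoc _ _ _).symm.trans (congrArg (· ≫ S.proj v) (lift_fst _ _))

theorem ctx_hom_ext {X : A.Obj} : ∀ {Δ : List Sg.Srt} {f g : X ⟶ S.ctx Δ},
    (∀ σ (v : Var Δ σ), f ≫ S.proj v = g ≫ S.proj v) → f = g
  | [], _, _, _ => toUnit_unique _ _
  | σ :: Δ, f, g, h => by
    refine CartesianMonoidalCategory.hom_ext (X := S.ctx Δ) (Y := S.srt σ) f g ?_ (h _ .zero)
    refine ctx_hom_ext fun τ v => ?_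
    exact (Category.assoc _ _ _).trans ((h _ (.succ v)).trans (Category.assoc _ _ _).symm)

theorem comp_tuple {X Y : A.Obj} (h : Y ⟶ X) {Δ : List Sg.Srt}
    (g : ∀ σ : Sg.Srt, Var Δ σ → (X ⟶ S.srt σ)) :
    h ≫ S.tuple g = S.tuple (fun σ v => h ≫ g σ v) :=
  S.ctx_hom_ext fun σ v => by rw [Category.assoc, tuple_proj, tuple_proj]

/-- The interpretation of a list of terms. -/
def terms {Γ Δ : List Sg.Srt} (γ : Subst Sg Γ Δ) : S.ctx Γ ⟶ S.ctx Δ :=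
  S.tuple (fun σ v => S.term (γ σ v))

theorem terms_proj {Γ Δ : List Sg.Srt} (γ : Subst Sg Γ Δ) {σ : Sg.Srt} (v : Var Δ σ) :
    S.terms γ ≫ S.proj v = S.term (γ σ v) := S.tuple_proj _ v

/-- Substitution is interpreted by composition. -/
theorem term_subst {Γ Δ : List Sg.Srt} (γ : Subst Sg Γ Δ) {σ : Sg.Srt} (M : Term Sg Δ σ) :
    S.term (M.subst γ) = S.terms γ ≫ S.term M := by
  induction M with
  | var v => exact (S.terms_proj γ v).symm
  | app f args ih =>
    refine Eq.trans (congrArg (· ≫ S.fn f) ?_) (Category.assoc _ _ _)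
    exact (congrArg S.tuple (funext fun σ => funext fun v => ih σ v)).trans
      (S.comp_tuple _ _).symm

theorem terms_comp {Γ Δ Θ : List Sg.Srt} (γ : Subst Sg Γ Δ) (δ : Subst Sg Δ Θ) :
    S.terms (γ.comp δ) = S.terms γ ≫ S.terms δ :=
  S.ctx_hom_ext fun σ v => by
    rw [terms_proj, Category.assoc, terms_proj]
    exact S.term_subst γ _

theorem terms_id (Γ : List Sg.Srt) : S.terms (Subst.id Γ) = 𝟙 (S.ctx Γ) :=
  S.ctx_hom_ext fun σ v => by
    rw [terms_proj, Category.id_comp]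
    rfl

theorem terms_wk (Γ : List Sg.Srt) (τ : Sg.Srt) :
    S.terms (Subst.wk Γ τ) = fst (S.ctx Γ) (S.srt τ) :=
  S.ctx_hom_ext fun σ v => by
    rw [terms_proj]
    rfl

theorem terms_up {Γ Δ : List Sg.Srt} (γ : Subst Sg Γ Δ) (τ : Sg.Srt) :
    S.terms (γ.up τ) = S.terms γ ▷ S.srt τ := by
  refine CartesianMonoidalCategory.hom_ext (X := S.ctx Δ) (Y := S.srt τ) _ _ ?_ ?_
  · refine (lift_fst _ _).trans (Eq.trans ?_ (whiskerRight_fst _ _).symm)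
    exact (S.terms_comp (Subst.wk Γ τ) γ).trans (congrArg (· ≫ S.terms γ) (S.terms_wk Γ τ))
  · exact (lift_snd _ _).trans (whiskerRight_snd _ _).symm

/-- Substitution in formulas is interpreted by reindexing. The case of a quantifier is the
naturality of the quantifier maps. -/
theorem formula_subst : ∀ {Γ Δ : List Sg.Srt} (γ : Subst Sg Γ Δ) (φ : Formula L Sg Δ),
    S.formula (φ.subst γ) = A.reindex (S.terms γ) (S.formula φ)
  | _, _, γ, .rel R args => by
    refine (congrArg (fun f => A.reindex f (S.rel R)) (S.terms_comp γ args)).trans ?_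
    exact A.reindex_comp _ _ _
  | _, _, γ, .eq (τ := τ) M N => by
    refine Eq.trans ?_ (A.reindex_comp _ _ _)
    refine congrArg (fun f => A.reindex f (A.eqPred (S.srt τ))) ?_
    rw [comp_lift, term_subst, term_subst]
  | _, _, γ, .conn k φ => by
    refine Eq.trans ?_ (A.reindex_conn k _ _).symm
    exact congrArg (A.conn k _) (funext fun i => formula_subst γ (φ i))
  | _, _, γ, .quant q σ φ => by
    refine Eq.trans ?_ (A.quant_natural q _ _ _)
    refine congrArg (A.quant q _ _) ?_
    exact (formula_subst (γ.up σ) φ).trans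
      (congrArg (fun f => A.reindex f (S.formula φ)) (S.terms_up γ σ))

theorem formula_unit (Γ : List Sg.Srt) : S.formula (.unit Γ) = A.unit (S.ctx Γ) :=
  congrArg (A.conn L.unit _) (funext fun i => i.elim0)

theorem formula_tens {Γ : List Sg.Srt} (φ ψ : Formula L Sg Γ) :
    S.formula (.tens φ ψ) = A.tens (S.formula φ) (S.formula ψ) :=
  congrArg (A.conn L.tensor _) (funext fun i => by fin_cases i <;> rfl)

end Str

/-! ### Soundness of the minimal logic -/

namespace PropCat

variable (A : PropCat.{u} L)

theorem tens_assoc {c : A.Obj} (r s t : A.Pred c) :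
    A.tens (A.tens r s) t = A.tens r (A.tens s t) := A.tensor_assoc c r s t

theorem unit_tens {c : A.Obj} (r : A.Pred c) : A.tens (A.unit c) r = r := A.unit_tensor c r

theorem tens_unit {c : A.Obj} (r : A.Pred c) : A.tens r (A.unit c) = r := A.tensor_unit c r

theorem tensAll_append {c : A.Obj} (rs ss : List (A.Pred c)) :
    A.tensAll (rs ++ ss) = A.tens (A.tensAll rs) (A.tensAll ss) := by
  induction rs with
  | nil => exact (A.unit_tens _).symm
  | cons r rs ih => exact (congrArg (A.tens r) ih).trans (A.tens_assoc _ _ _).symm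

theorem tensAll_singleton {c : A.Obj} (r : A.Pred c) : A.tensAll [r] = r := A.tens_unit r

theorem reindex_unit {c d : A.Obj} (f : c ⟶ d) : A.reindex f (A.unit d) = A.unit c :=
  (A.reindex_conn L.unit f _).trans (congrArg (A.conn L.unit c) (funext fun i => i.elim0))

theorem reindex_tens {c d : A.Obj} (f : c ⟶ d) (r s : A.Pred d) :
    A.reindex f (A.tens r s) = A.tens (A.reindex f r) (A.reindex f s) :=
  (A.reindex_conn L.tensor f _).trans
    (congrArg (A.conn L.tensor c) (funext fun i => by fin_cases i <;> rfl))

theorem reindex_tensAll {c d : A.Obj} (f : c ⟶ d) (rs : List (A.Pred d)) :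
    A.reindex f (A.tensAll rs) = A.tensAll (rs.map (A.reindex f)) := by
  induction rs with
  | nil => exact A.reindex_unit f
  | cons r rs ih => exact (A.reindex_tens f _ _).trans (congrArg (A.tens _) ih)

end PropCat

namespace Str

variable {A : PropCat.{u} L} (S : Str Sg A)

theorem satisfies_singleton {Γ : List Sg.Srt} {φ ψ : Formula L Sg Γ} :
    S.Satisfies (.seq [φ] ψ) ↔ S.formula φ ≤ S.formula ψ := by
  show A.tensAll [S.formula φ] ≤ _ ↔ _
  rw [A.tensAll_singleton]

theorem satisfies_sub {Γ Δ : List Sg.Srt} {γ γ' : Subst Sg Γ Δ} {Φ : List (Formula L Sg Δ)}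
    {ψ : Formula L Sg Δ} (h : S.terms γ = S.terms γ') (hs : S.Satisfies (.seq Φ ψ)) :
    S.Satisfies (.seq (Φ.map (Formula.subst γ)) (ψ.subst γ')) := by
  have := (A.reindex (S.terms γ)).monotone hs
  rw [A.reindex_tensAll, List.map_map] at this
  show A.tensAll ((Φ.map (Formula.subst γ)).map S.formula) ≤ S.formula (ψ.subst γ')
  rw [List.map_map, formula_subst, ← h]
  convert this using 4
  exact funext (S.formula_subst γ)

theorem terms_congr {Γ Δ : List Sg.Srt} {γ γ' : Subst Sg Γ Δ}
    (h : ∀ σ v, S.Satisfies (.eqn (γ σ v) (γ' σ v))) : S.terms γ = S.terms γ' :=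
  congrArg S.tuple (funext fun σ => funext fun v => h σ v)

/-- The theory of a structure is closed under the rules of the minimal logic. -/
def minimalTheory : MinimalTheory L Sg where
  carrier := S.theory
  eq_refl _ := rfl
  eq_symm h := Eq.symm h
  eq_trans h h' := Eq.trans h h'
  eq_sub {Γ Δ τ γ γ' N N'} h h' := by
    show S.term _ = S.term _
    rw [term_subst, term_subst, S.terms_congr h]
    exact congrArg _ h'
  ax φ := S.satisfies_singleton.2 le_rfl
  cut h h' := S.satisfies_singleton.2
    ((S.satisfies_singleton.1 h).trans (S.satisfies_singleton.1 h'))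
  cwk _ h := S.satisfies_sub rfl h
  sub h h' := S.satisfies_sub (S.terms_congr h) h'
  quant_con q σ φ ψ h h' := S.satisfies_singleton.2 (le_of_eq
    (congrArg (A.quant q _ _)
      (le_antisymm (S.satisfies_singleton.1 h) (S.satisfies_singleton.1 h'))))
  conn_cong k φ ψ h h' := S.satisfies_singleton.2 (le_of_eq
    (congrArg (A.conn k _) (funext fun i =>
      le_antisymm (S.satisfies_singleton.1 (h i)) (S.satisfies_singleton.1 (h' i)))))
  tensor_ref {Γ} Φ Ψ α β θ := by
    show A.tensAll _ ≤ _ ↔ A.tensAll _ ≤ _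
    rw [List.map_append, List.map_append, A.tensAll_append, A.tensAll_append]
    have : A.tensAll ((α :: β :: Ψ).map S.formula) =
        A.tensAll ((Formula.tens α β :: Ψ).map S.formula) :=
      (A.tens_assoc _ _ _).symm.trans
        (congrArg (fun r => A.tens r _) (S.formula_tens α β).symm)
    rw [this]
  unit_ref {Γ} Φ Ψ φ := by
    show A.tensAll _ ≤ _ ↔ A.tensAll _ ≤ _
    rw [List.map_append, List.map_append, A.tensAll_append, A.tensAll_append]
    have : A.tensAll ((Formula.unit Γ :: Ψ).map S.formula) = A.tensAll (Ψ.map S.formula) :=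
      (congrArg (fun r => A.tens r _) (S.formula_unit Γ)).trans (A.unit_tens _)
    rw [this]

end Str

/-! ### Transport of structures along morphisms of prop-categories -/

theorem map_lift_comp_prodComparison {C D : Type u} [Category.{u} C] [Category.{u} D]
    [CartesianMonoidalCategory C] [CartesianMonoidalCategory D] (F : C ⥤ D) {X Y Z : C}
    (f : X ⟶ Y) (g : X ⟶ Z) :
    F.map (lift f g) ≫ prodComparison F Y Z = lift (F.map f) (F.map g) := by
  apply CartesianMonoidalCategory.hom_ext
  · rw [Category.assoc, prodComparison_fst, ← F.map_comp, lift_fst, lift_fst]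
  · rw [Category.assoc, prodComparison_snd, ← F.map_comp, lift_snd, lift_snd]

theorem preservesFiniteProducts_of_isIso_comparison {C D : Type u} [Category.{u} C]
    [Category.{u} D] [CartesianMonoidalCategory C] [CartesianMonoidalCategory D] (F : C ⥤ D)
    [IsIso (terminalComparison F)] [∀ X Y, IsIso (prodComparison F X Y)] :
    Limits.PreservesFiniteProducts F := by
  have := preservesLimitsOfShape_discrete_walkingPair_of_isIso_prodComparison F
  have := preservesLimit_empty_of_isIso_terminalComparison F
  have := Limits.preservesLimitsOfShape_pempty_of_preservesTerminal F
  exact .of_preserves_binary_and_terminal F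

namespace PropCat

theorem reindex_le_iff (A : PropCat.{u} L) {c d : A.Obj} (f : c ⟶ d) [IsIso f]
    {r s : A.Pred d} : A.reindex f r ≤ A.reindex f s ↔ r ≤ s := by
  refine ⟨fun h => ?_, fun h => (A.reindex f).monotone h⟩
  have := (A.reindex (inv f)).monotone h
  rwa [← A.reindex_comp, ← A.reindex_comp, IsIso.inv_hom_id, A.reindex_id, A.reindex_id] at this

namespace Hom

attribute [instance] Hom.preserves

variable {A B : PropCat.{u} L} (F : Hom A B)

theorem app_unit (c : A.Obj) : F.app c (A.unit c) = B.unit (F.functor.obj c) :=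
  (F.app_conn L.unit c _).trans (congrArg (B.conn L.unit _) (funext fun i => i.elim0))

theorem app_tens {c : A.Obj} (r s : A.Pred c) :
    F.app c (A.tens r s) = B.tens (F.app c r) (F.app c s) :=
  (F.app_conn L.tensor c _).trans
    (congrArg (B.conn L.tensor _) (funext fun i => by fin_cases i <;> rfl))

theorem app_tensAll {c : A.Obj} (rs : List (A.Pred c)) :
    F.app c (A.tensAll rs) = B.tensAll (rs.map (F.app c)) := by
  induction rs with
  | nil => exact F.app_unit c
  | cons r rs ih => exact (F.app_tens _ _).trans (congrArg (B.tens _) ih)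

/-- The canonical comparison from the image of the interpretation of a context to the
interpretation of the context by the images of its sorts. -/
def ctxComparison {S : Type u} (srt : S → A.Obj) : ∀ Γ : List S,
    F.functor.obj (ctxObj A srt Γ) ⟶ ctxObj B (fun σ => F.functor.obj (srt σ)) Γ
  | [] => toUnit _
  | σ :: Γ => prodComparison F.functor (ctxObj A srt Γ) (srt σ) ≫
      (ctxComparison srt Γ ▷ F.functor.obj (srt σ))

instance isIso_ctxComparison {S : Type u} (srt : S → A.Obj) :
    ∀ Γ : List S, IsIso (F.ctxComparison srt Γ)
  | [] => inferInstanceAs (IsIso (terminalComparison F.functor))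
  | σ :: Γ => by
    have := isIso_ctxComparison srt Γ
    exact inferInstanceAs (IsIso (prodComparison F.functor (ctxObj A srt Γ) (srt σ) ≫
      (F.ctxComparison srt Γ ▷ F.functor.obj (srt σ))))

/-- The image of a structure under a morphism of prop-categories. -/
def mapStr (S : Str Sg A) : Str Sg B where
  srt σ := F.functor.obj (S.srt σ)
  fn {as _} f := inv (F.ctxComparison S.srt as) ≫ F.functor.map (S.fn f)
  rel {as} R := B.reindex (inv (F.ctxComparison S.srt as)) (F.app _ (S.rel R))

variable (S : Str Sg A)

/-- The comparison of interpretations of contexts for the image of a structure. -/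
def comparison (Γ : List Sg.Srt) : F.functor.obj (S.ctx Γ) ⟶ (F.mapStr S).ctx Γ :=
  F.ctxComparison S.srt Γ

instance (Γ : List Sg.Srt) : IsIso (F.comparison S Γ) := F.isIso_ctxComparison S.srt Γ

theorem comparison_proj : ∀ {Γ : List Sg.Srt} {σ : Sg.Srt} (v : Var Γ σ),
    F.comparison S Γ ≫ (F.mapStr S).proj v = F.functor.map (S.proj v)
  | τ :: Γ, _, .zero => by
    refine (Category.assoc (prodComparison F.functor (S.ctx Γ) (S.srt τ))
      (F.comparison S Γ ▷ F.functor.obj (S.srt τ)) (snd _ _)).trans ?_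
    rw [whiskerRight_snd, prodComparison_snd]
    rfl
  | τ :: Γ, σ, .succ v => by
    refine (Category.assoc (prodComparison F.functor (S.ctx Γ) (S.srt τ))
      (F.comparison S Γ ▷ F.functor.obj (S.srt τ))
      (fst _ _ ≫ (F.mapStr S).proj v)).trans ?_
    rw [whiskerRight_fst_assoc, prodComparison_fst_assoc, comparison_proj v]
    exact (F.functor.map_comp _ _).symm

theorem map_tuple {X : A.Obj} {Δ : List Sg.Srt} (g : ∀ σ : Sg.Srt, Var Δ σ → (X ⟶ S.srt σ)) :
    F.functor.map (S.tuple g) ≫ F.comparison S Δ =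
      (F.mapStr S).tuple (fun σ v => F.functor.map (g σ v)) :=
  (F.mapStr S).ctx_hom_ext fun σ v => by
    rw [Category.assoc, comparison_proj]
    refine (F.functor.map_comp _ _).symm.trans (Eq.trans ?_ ((F.mapStr S).tuple_proj _ v).symm)
    exact congrArg F.functor.map (S.tuple_proj g v)

/-- The interpretation of a term in the image structure, up to the comparison of contexts. -/
theorem map_term {Γ : List Sg.Srt} {σ : Sg.Srt} (M : Term Sg Γ σ) :
    F.functor.map (S.term M) = F.comparison S Γ ≫ (F.mapStr S).term M := by
  induction M with
  | var v => exact (F.comparison_proj S v).symm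
  | @app as τ f args ih =>
    have h : F.functor.map (S.terms args) ≫ F.comparison S as =
        F.comparison S Γ ≫ (F.mapStr S).terms args := by
      refine (F.map_tuple S _).trans (Eq.trans ?_ ((F.mapStr S).comp_tuple _ _).symm)
      exact congrArg (F.mapStr S).tuple (funext fun σ => funext fun v => ih σ v)
    have h' : F.comparison S as ≫ (F.mapStr S).fn f = F.functor.map (S.fn f) :=
      IsIso.hom_inv_id_assoc (F.ctxComparison S.srt as) _
    refine (F.functor.map_comp (S.terms args) (S.fn f)).trans ?_
    refine (congrArg (F.functor.map (S.terms args) ≫ ·) h'.symm).trans ?_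
    refine (Category.assoc _ _ _).symm.trans (Eq.trans ?_ (Category.assoc _ _ _))
    exact congrArg (· ≫ (F.mapStr S).fn f) h

theorem map_terms {Γ Δ : List Sg.Srt} (γ : Subst Sg Γ Δ) :
    F.functor.map (S.terms γ) ≫ F.comparison S Δ =
      F.comparison S Γ ≫ (F.mapStr S).terms γ := by
  refine (F.map_tuple S _).trans (Eq.trans ?_ ((F.mapStr S).comp_tuple _ _).symm)
  exact congrArg (F.mapStr S).tuple (funext fun σ => funext fun v => F.map_term S (γ σ v))

/-- The interpretation of a formula in the image structure, up to the comparison of contexts. -/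
theorem app_formula : ∀ {Γ : List Sg.Srt} (φ : Formula L Sg Γ),
    F.app (S.ctx Γ) (S.formula φ) = B.reindex (F.comparison S Γ) ((F.mapStr S).formula φ)
  | Γ, .rel (as := as) R args => by
    have h : F.app (S.ctx as) (S.rel R) =
        B.reindex (F.comparison S as) ((F.mapStr S).rel R) := by
      refine Eq.trans ?_ (B.reindex_comp (F.ctxComparison S.srt as) (inv _) _)
      rw [IsIso.hom_inv_id, B.reindex_id]
      rfl
    calc F.app (S.ctx Γ) (S.formula (.rel R args))
        = B.reindex (F.functor.map (S.terms args)) (F.app (S.ctx as) (S.rel R)) :=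
          F.naturality _ _
      _ = B.reindex (F.functor.map (S.terms args)) (B.reindex (F.comparison S as)
            ((F.mapStr S).rel R)) := congrArg _ h
      _ = B.reindex (F.functor.map (S.terms args) ≫ F.comparison S as) ((F.mapStr S).rel R) :=
          (B.reindex_comp _ _ _).symm
      _ = B.reindex (F.comparison S Γ ≫ (F.mapStr S).terms args) ((F.mapStr S).rel R) :=
          congrArg (fun f => B.reindex f ((F.mapStr S).rel R)) (F.map_terms S args)
      _ = _ := B.reindex_comp _ _ _
  | Γ, .eq (τ := τ) M N => by
    have h : F.functor.map (lift (S.term M) (S.term N)) ≫ prodComparison F.functor _ _ =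
        F.comparison S Γ ≫ lift ((F.mapStr S).term M) ((F.mapStr S).term N) := by
      rw [map_lift_comp_prodComparison, comp_lift, map_term, map_term]
      rfl
    refine (F.naturality _ _).trans ?_
    rw [F.app_eqPred, ← B.reindex_comp, h]
    exact B.reindex_comp _ _ _
  | Γ, .conn k φ => by
    refine (F.app_conn k _ _).trans (Eq.trans ?_ (B.reindex_conn k _ _).symm)
    exact congrArg (B.conn k _) (funext fun i => app_formula (φ i))
  | Γ, .quant q σ φ => by
    have h : B.reindex (inv (prodComparison F.functor (S.ctx Γ) (S.srt σ)))
        (F.app (S.ctx Γ ⊗ S.srt σ) (S.formula φ)) =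
          B.reindex (F.comparison S Γ ▷ F.functor.obj (S.srt σ)) ((F.mapStr S).formula φ) := by
      refine (congrArg (B.reindex _) (app_formula φ)).trans ?_
      refine (B.reindex_comp (inv (prodComparison F.functor (S.ctx Γ) (S.srt σ)))
        (prodComparison F.functor (S.ctx Γ) (S.srt σ) ≫
          (F.comparison S Γ ▷ F.functor.obj (S.srt σ))) _).symm.trans ?_
      exact congrArg (fun f => B.reindex f ((F.mapStr S).formula φ)) (IsIso.inv_hom_id_assoc _ _)
    refine (F.app_quant q _ _ _).trans ((congrArg (B.quant q _ _) h).trans ?_)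
    exact B.quant_natural q _ _ _

theorem mapStr_satisfies_eqn {Γ : List Sg.Srt} {τ : Sg.Srt} {M N : Term Sg Γ τ} :
    (F.mapStr S).Satisfies (.eqn M N) ↔
      F.functor.map (S.term M) = F.functor.map (S.term N) := by
  rw [map_term, map_term]
  exact (cancel_epi (F.comparison S Γ)).symm

theorem mapStr_satisfies_seq {Γ : List Sg.Srt} {Φ : List (Formula L Sg Γ)}
    {ψ : Formula L Sg Γ} : (F.mapStr S).Satisfies (.seq Φ ψ) ↔
      F.app _ (A.tensAll (Φ.map S.formula)) ≤ F.app _ (S.formula ψ) := by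
  have h : F.app _ (A.tensAll (Φ.map S.formula)) =
      B.reindex (F.comparison S Γ) (B.tensAll (Φ.map (F.mapStr S).formula)) := by
    rw [app_tensAll, B.reindex_tensAll, List.map_map, List.map_map]
    exact congrArg (fun f => B.tensAll (Φ.map f)) (funext (F.app_formula S))
  rw [h, app_formula]
  exact (B.reindex_le_iff (F.comparison S Γ)).symm

theorem mapStr_satisfies {a : Assertion L Sg} (h : S.Satisfies a) :
    (F.mapStr S).Satisfies a := by
  cases a with
  | eqn M N => exact (F.mapStr_satisfies_eqn S).2 (congrArg F.functor.map h)
  | seq Φ ψ => exact (F.mapStr_satisfies_seq S).2 ((F.app _).monotone h)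

/-- A family of morphisms out of a prop-category is jointly conservative if it is jointly faithful
and jointly reflects the order of the posets. -/
structure JointlyConservative {I : Type u} {B : I → PropCat.{u} L} (F : ∀ i, Hom A (B i)) :
    Prop where
  faithful : ∀ {c d : A.Obj} (f g : c ⟶ d),
    (∀ i, (F i).functor.map f = (F i).functor.map g) → f = g
  reflects : ∀ {c : A.Obj} (r s : A.Pred c), (∀ i, (F i).app c r ≤ (F i).app c s) → r ≤ s

/-- An assertion holds in a structure as soon as it holds in all of its images under a jointly
conservative family of morphisms. -/
theorem JointlyConservative.satisfies {I : Type u} {B : I → PropCat.{u} L}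
    {F : ∀ i, Hom A (B i)} (hF : JointlyConservative F) (S : Str Sg A) {a : Assertion L Sg}
    (h : ∀ i, ((F i).mapStr S).Satisfies a) : S.Satisfies a := by
  cases a with
  | eqn M N => exact hF.faithful _ _ fun i => ((F i).mapStr_satisfies_eqn S).1 (h i)
  | seq Φ ψ => exact hF.reflects _ _ fun i => ((F i).mapStr_satisfies_seq S).1 (h i)

end Hom

end PropCat

/-! ### Models as morphisms out of the classifying prop-category -/

section CartesianCategory

variable {C : Type u} [Category.{u} C] [CartesianMonoidalCategory C]

theorem lift_whiskerRight_eq {W X Y Z : C} (f : W ⟶ X) (g : W ⟶ Y) :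
    lift (fst W Z ≫ f) (g ▷ Z) = (lift f g ▷ Z) ≫ (α_ X Y Z).hom := by
  apply CartesianMonoidalCategory.hom_ext
  · simp
  · apply CartesianMonoidalCategory.hom_ext <;> simp

theorem whiskerRight_associator_inv_id {W X Y Z : C} (f : W ⟶ X ⊗ Y) [IsIso f] :
    ((f ▷ Z) ≫ (α_ X Y Z).hom) ≫ ((α_ X Y Z).inv ≫ (inv f ▷ Z)) = 𝟙 (W ⊗ Z) := by
  simp [← comp_whiskerRight]

theorem lift_lift_fst {W X Y : C} (f f' : W ⟶ X) (g g' : W ⟶ Y) :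
    lift (lift f g) (lift f' g') ≫
      lift (fst (X ⊗ Y) (X ⊗ Y) ≫ fst X Y) (snd (X ⊗ Y) (X ⊗ Y) ≫ fst X Y) = lift f f' := by
  rw [comp_lift]
  simp

theorem lift_lift_snd {W X Y : C} (f f' : W ⟶ X) (g g' : W ⟶ Y) :
    lift (lift f g) (lift f' g') ≫
      lift (fst (X ⊗ Y) (X ⊗ Y) ≫ snd X Y) (snd (X ⊗ Y) (X ⊗ Y) ≫ snd X Y) = lift g g' := by
  rw [comp_lift]
  simp

end CartesianCategory

namespace Str

variable {A : PropCat.{u} L} (S : Str Sg A)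

/-- The comparison from the interpretation of a juxtaposition of contexts to the product of their
interpretations. -/
def split (Γ Δ : List Sg.Srt) : S.ctx (Δ ++ Γ) ⟶ S.ctx Γ ⊗ S.ctx Δ :=
  lift (S.terms (Subst.fst Γ Δ)) (S.terms (Subst.snd Γ Δ))

theorem split_nil (Γ : List Sg.Srt) : S.split Γ [] ≫ fst (S.ctx Γ) (𝟙_ A.Obj) = 𝟙 (S.ctx Γ) :=
  (lift_fst _ _).trans (S.terms_id Γ)

theorem split_nil' (Γ : List Sg.Srt) : fst (S.ctx Γ) (𝟙_ A.Obj) ≫ S.split Γ [] = 𝟙 _ := by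
  refine CartesianMonoidalCategory.hom_ext _ _ ?_ (toUnit_unique _ _)
  refine (Category.assoc _ _ _).trans ((congrArg _ (S.split_nil Γ)).trans ?_)
  rw [Category.comp_id]
  exact (Category.id_comp _).symm

/-- The recursion that matches the law of the quantifier maps for a product of two objects. -/
theorem split_cons (Γ Δ : List Sg.Srt) (σ : Sg.Srt) :
    S.split Γ (σ :: Δ) = (S.split Γ Δ ▷ S.srt σ) ≫ (α_ (S.ctx Γ) (S.ctx Δ) (S.srt σ)).hom := by
  have h1 : S.terms (Subst.fst Γ (σ :: Δ)) =
      fst (S.ctx (Δ ++ Γ)) (S.srt σ) ≫ S.terms (Subst.fst Γ Δ) :=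
    (S.terms_comp (Subst.wk (Δ ++ Γ) σ) (Subst.fst Γ Δ)).trans
      (congrArg (· ≫ S.terms (Subst.fst Γ Δ)) (S.terms_wk _ σ))
  have h2 : S.terms (Subst.snd Γ (σ :: Δ)) = S.terms (Subst.snd Γ Δ) ▷ S.srt σ :=
    S.terms_up _ σ
  exact (congrArg₂ lift h1 h2).trans (lift_whiskerRight_eq _ _)

instance isIso_split (Γ : List Sg.Srt) : ∀ Δ : List Sg.Srt, IsIso (S.split Γ Δ)
  | [] => ⟨fst (S.ctx Γ) (𝟙_ A.Obj), S.split_nil Γ, S.split_nil' Γ⟩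
  | σ :: Δ => by
    have := isIso_split Γ Δ
    rw [split_cons]
    exact inferInstanceAs (IsIso
      ((S.split Γ Δ ▷ S.srt σ) ≫ (α_ (S.ctx Γ) (S.ctx Δ) (S.srt σ)).hom))

/-- Iterated quantification over the variables of a context is quantification over its
interpretation. -/
theorem formula_quantAll (q : L.Quant) {Γ : List Sg.Srt} :
    ∀ (Δ : List Sg.Srt) (φ : Formula L Sg (Δ ++ Γ)),
      S.formula (.quantAll q Δ φ) =
        A.quant q (S.ctx Γ) (S.ctx Δ) (A.reindex (inv (S.split Γ Δ)) (S.formula φ))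
  | [], φ => by
    have h : inv (S.split Γ []) = fst (S.ctx Γ) (𝟙_ A.Obj) :=
      IsIso.inv_eq_of_hom_inv_id (S.split_nil Γ)
    rw [h]
    exact (A.quant_one q _ _).symm
  | σ :: Δ, φ => by
    have h : inv (S.split Γ (σ :: Δ)) =
        (α_ (S.ctx Γ) (S.ctx Δ) (S.srt σ)).inv ≫ (inv (S.split Γ Δ) ▷ S.srt σ) := by
      refine IsIso.inv_eq_of_hom_inv_id ?_
      rw [split_cons]
      exact whiskerRight_associator_inv_id _
    rw [h]
    calc S.formula (.quantAll q Δ (.quant q σ φ))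
        = A.quant q (S.ctx Γ) (S.ctx Δ) (A.reindex (inv (S.split Γ Δ))
            (A.quant q (S.ctx (Δ ++ Γ)) (S.srt σ) (S.formula φ))) := formula_quantAll q Δ _
      _ = A.quant q (S.ctx Γ) (S.ctx Δ) (A.quant q (S.ctx Γ ⊗ S.ctx Δ) (S.srt σ)
            (A.reindex (inv (S.split Γ Δ) ▷ S.srt σ) (S.formula φ))) :=
          congrArg _ (A.quant_natural q _ _ _).symm
      _ = A.quant q (S.ctx Γ) (S.ctx Δ ⊗ S.srt σ)
            (A.reindex (α_ (S.ctx Γ) (S.ctx Δ) (S.srt σ)).inv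
              (A.reindex (inv (S.split Γ Δ) ▷ S.srt σ) (S.formula φ))) :=
          (A.quant_prod q _ _ _ _).symm
      _ = _ := congrArg (A.quant q (S.ctx Γ) (S.ctx Δ ⊗ S.srt σ)) (A.reindex_comp _ _ _).symm

/-- The conjunction of equations between the entries of two lists of terms is the equality
predicate of the interpretation of their context. -/
theorem formula_eqAll {Γ : List Sg.Srt} : ∀ {Δ : List Sg.Srt} (γ δ : Subst Sg Γ Δ),
    S.formula (.eqAll γ δ) =
      A.reindex (lift (S.terms γ) (S.terms δ)) (A.eqPred (S.ctx Δ))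
  | [], γ, δ => by
    refine (S.formula_unit Γ).trans ?_
    refine Eq.trans ?_ (congrArg (A.reindex (lift (S.terms γ) (S.terms δ))) A.eqPred_one.symm)
    exact (A.reindex_unit _).symm
  | σ :: Δ, γ, δ => by
    refine (S.formula_tens _ _).trans ?_
    refine Eq.trans ?_ (congrArg (A.reindex (lift (S.terms γ) (S.terms δ)))
      (A.eqPred_prod (S.ctx Δ) (S.srt σ)).symm)
    refine Eq.trans ?_ (A.reindex_tens _ _ _).symm
    refine congrArg₂ A.tens ?_ ?_
    · refine (formula_eqAll _ _).trans (Eq.trans ?_ (A.reindex_comp _ _ _))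
      exact congrArg (fun f => A.reindex f (A.eqPred (S.ctx Δ))) (lift_lift_fst _ _ _ _).symm
    · refine Eq.trans ?_ (A.reindex_comp _ _ _)
      exact congrArg (fun f => A.reindex f (A.eqPred (S.srt σ))) (lift_lift_snd _ _ _ _).symm

end Str

namespace MinimalTheory

variable (T : MinimalTheory L Sg) {A : PropCat.{u} L} {S : Str Sg A} (h : S.IsModel T.carrier)

/-- The functor on contexts given by a model of a theory. -/
def modelFunctor : T.Ctx ⥤ A.Obj where
  obj Γ := S.ctx Γ.ctx
  map := Quotient.lift S.terms (fun _ _ e => S.terms_congr fun σ v => h (e σ v))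
  map_id Γ := S.terms_id Γ.ctx
  map_comp {Γ Δ Θ} f g := by
    induction f using T.hom_ind with
    | h γ =>
      induction g using T.hom_ind with
      | h δ => exact S.terms_comp γ δ

-- The comparison of products for this functor is `S.split` by definition.
instance (Γ Δ : T.Ctx) : IsIso (prodComparison (T.modelFunctor h) Γ Δ) :=
  S.isIso_split Γ.ctx Δ.ctx

instance : IsIso (terminalComparison (T.modelFunctor h)) :=
  ⟨𝟙 (𝟙_ A.Obj), toUnit_unique _ _, toUnit_unique _ _⟩

/-- The morphism out of the classifying prop-category of a theory given by a model. -/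
def modelHom : PropCat.Hom T.classifying A where
  functor := T.modelFunctor h
  preserves := preservesFiniteProducts_of_isIso_comparison (T.modelFunctor h)
  app Γ :=
    { toFun := Quotient.lift (s := T.formulaSetoid Γ.ctx) S.formula (fun _ _ e => le_antisymm
        (S.satisfies_singleton.1 (h e.1)) (S.satisfies_singleton.1 (h e.2)))
      monotone' := T.cls_ind fun _ => T.cls_ind fun _ e => S.satisfies_singleton.1 (h e) }
  naturality {Γ Δ} f := T.cls_ind fun φ => by
    induction f using T.hom_ind with
    | h γ => exact S.formula_subst γ φ
  app_conn k Γ := T.conn_ind fun φ => congrArg _ (T.conn_cls k φ)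
  app_quant q Γ Δ := T.cls_ind fun φ => S.formula_quantAll q Δ.ctx φ
  app_eqPred Γ := S.formula_eqAll _ _

/-- The morphisms given by a family of models are jointly conservative if every assertion that holds
in all of the models belongs to the theory. -/
theorem jointlyConservative_modelHom {I : Type u} {A : I → PropCat.{u} L} {S : ∀ i, Str Sg (A i)}
    (h : ∀ i, (S i).IsModel T.carrier) (hS : ∀ a, (∀ i, (S i).Satisfies a) → a ∈ T.carrier) :
    PropCat.Hom.JointlyConservative (fun i => T.modelHom (h i)) where
  faithful {Γ Δ} f g := by
    induction f using T.hom_ind with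
    | h γ =>
      induction g using T.hom_ind with
      | h δ =>
        intro e
        refine T.hom_eq_iff.2 fun σ v => hS _ fun i => ?_
        have := congrArg (· ≫ (S i).proj v) (e i)
        exact ((S i).terms_proj γ v).symm.trans (this.trans ((S i).terms_proj δ v))
  reflects {Γ} := T.cls_ind fun φ => T.cls_ind fun ψ => fun e =>
    hS (.seq [φ] ψ) fun i => (S i).satisfies_singleton.2 (e i)

end MinimalTheory

/-! ### The generic model -/

/-- The one-term list. -/
def Subst.single {Γ : List Sg.Srt} {τ : Sg.Srt} (M : Term Sg Γ τ) : Subst Sg Γ [τ] :=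
  Subst.cons (fun _ v => nomatch v) M

theorem Subst.comp_single {Γ Δ : List Sg.Srt} {τ : Sg.Srt} (γ : Subst Sg Γ Δ)
    (M : Term Sg Δ τ) : γ.comp (Subst.single M) = Subst.single (M.subst γ) :=
  Subst.ext_cons rfl (fun _ v => nomatch v)

/-- The formula `φ₁ ⊗ (… ⊗ (φₙ ⊗ e))`. -/
def Formula.tensList {Γ : List Sg.Srt} (Φ : List (Formula L Sg Γ)) : Formula L Sg Γ :=
  Φ.foldr .tens (.unit Γ)

namespace MinimalTheory

variable (T : MinimalTheory L Sg)

/-- By the rules for `⊗` and `e`, a tail of hypotheses may be replaced by its product. -/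
theorem seq_append_tensList {Γ : List Sg.Srt} {ψ : Formula L Sg Γ} :
    ∀ Φ Ψ : List (Formula L Sg Γ),
      .seq (Ψ ++ Φ) ψ ∈ T.carrier ↔ .seq (Ψ ++ [.tensList Φ]) ψ ∈ T.carrier
  | [], Ψ => (T.unit_ref Ψ [] ψ).symm
  | φ :: Φ, Ψ => by
    have h := seq_append_tensList (ψ := ψ) Φ (Ψ ++ [φ])
    rw [List.append_assoc, List.append_assoc] at h
    exact h.trans (T.tensor_ref Ψ [] φ (.tensList Φ) ψ)

/-- A context, as an object of the classifying prop-category. Together with `arrow` and `pred` it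
keeps types and instances in the form `T.classifying.Obj`, which instance resolution does not unfold
to `T.Ctx`. -/
def obj (Γ : List Sg.Srt) : T.classifying.Obj := (⟨Γ⟩ : T.Ctx)

/-- The class of a list of terms, as a morphism of the classifying prop-category. -/
def arrow {Γ Δ : List Sg.Srt} (γ : Subst Sg Γ Δ) : T.obj Γ ⟶ T.obj Δ :=
  (T.hom γ : (⟨Γ⟩ : T.Ctx) ⟶ ⟨Δ⟩)

/-- The class of a formula, as a predicate of the classifying prop-category. -/
def pred {Γ : List Sg.Srt} (φ : Formula L Sg Γ) : T.classifying.Pred (T.obj Γ) :=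
  T.cls ⟨Γ⟩ φ

variable {T} in
theorem arrow_eq_iff {Γ Δ : List Sg.Srt} {γ γ' : Subst Sg Γ Δ} :
    T.arrow γ = T.arrow γ' ↔ ∀ σ v, .eqn (γ σ v) (γ' σ v) ∈ T.carrier := T.hom_eq_iff

theorem tensAll_map_pred {Γ : List Sg.Srt} (Φ : List (Formula L Sg Γ)) :
    T.classifying.tensAll (Φ.map T.pred) = T.pred (.tensList Φ) := by
  induction Φ with
  | nil => exact T.conn_unit_cls ⟨Γ⟩
  | cons φ Φ ih =>
    exact (congrArg (T.classifying.tens (T.pred φ)) ih).trans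
      (T.conn_tensor_cls (Γ := ⟨Γ⟩) _ _)

theorem tensAll_map_pred_le_iff {Γ : List Sg.Srt} {Φ : List (Formula L Sg Γ)}
    {ψ : Formula L Sg Γ} :
    T.classifying.tensAll (Φ.map T.pred) ≤ T.pred ψ ↔ .seq Φ ψ ∈ T.carrier := by
  rw [tensAll_map_pred]
  exact (T.seq_append_tensList Φ []).symm

theorem reindex_eqPred {Γ Δ : List Sg.Srt} (γ δ : Subst Sg Γ Δ) :
    T.classifying.reindex (lift (T.arrow γ) (T.arrow δ)) (T.classifying.eqPred (T.obj Δ)) =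
      T.pred (.eqAll γ δ) := by
  refine (congrArg (fun f => T.reindex f (T.eqPred ⟨Δ⟩))
    (T.lift_hom (Θ := ⟨Γ⟩) (Γ := ⟨Δ⟩) (Δ := ⟨Δ⟩) γ δ)).trans ?_
  refine congrArg T.pred ((Formula.eqAll_subst _ _ _).trans ?_)
  rw [Subst.append_fst, Subst.append_snd]

/-- The identification of a context with the product of its sorts. -/
def ctxIso : ∀ Γ : List Sg.Srt,
    T.obj Γ ⟶ ctxObj T.classifying (fun σ => T.obj [σ]) Γ
  | [] => 𝟙 (T.obj [])
  | σ :: Γ => (ctxIso Γ ▷ T.obj [σ] : T.obj Γ ⊗ T.obj [σ] ⟶ _)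

instance isIso_ctxIso : ∀ Γ : List Sg.Srt, IsIso (T.ctxIso Γ)
  | [] => inferInstanceAs (IsIso (𝟙 (T.obj [])))
  | σ :: Γ => by
    have := isIso_ctxIso Γ
    exact inferInstanceAs (IsIso (T.ctxIso Γ ▷ T.obj [σ]))

/-- The generic structure of a theory, in its classifying prop-category. -/
def generic : Str Sg T.classifying where
  srt σ := T.obj [σ]
  fn {as _} f := inv (T.ctxIso as) ≫ T.arrow (Subst.single (.app f (Subst.id as)))
  rel {as} R := T.classifying.reindex (inv (T.ctxIso as)) (T.pred (.rel R (Subst.id as)))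

/-- The identification of a context with its interpretation in the generic structure. -/
def toGeneric (Γ : List Sg.Srt) : T.obj Γ ⟶ T.generic.ctx Γ := T.ctxIso Γ

instance (Γ : List Sg.Srt) : IsIso (T.toGeneric Γ) := T.isIso_ctxIso Γ

theorem toGeneric_proj : ∀ {Γ : List Sg.Srt} {σ : Sg.Srt} (v : Var Γ σ),
    T.toGeneric Γ ≫ T.generic.proj v = T.arrow (Subst.single (.var v))
  | σ :: Γ, _, .zero => by
    refine (whiskerRight_snd (T.ctxIso Γ) (T.obj [σ])).trans ?_
    exact congrArg (T.arrow (Γ := σ :: Γ)) (Subst.ext_cons rfl (fun _ v => nomatch v))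
  | σ :: Γ, _, .succ v => by
    refine (whiskerRight_fst_assoc (T.ctxIso Γ) (T.obj [σ]) (T.generic.proj v)).trans ?_
    refine (congrArg (fst (T.obj Γ) (T.obj [σ]) ≫ ·) (toGeneric_proj v)).trans ?_
    exact congrArg T.arrow (Subst.comp_single (Subst.wk Γ σ) (.var v))

/-- If the entries of a tuple of morphisms are the classes of the terms of a list, then the tuple is
the class of the list. -/
theorem toGeneric_tuple {Γ Δ : List Sg.Srt} (γ : Subst Sg Γ Δ)
    (g : ∀ σ : Sg.Srt, Var Δ σ → (T.generic.ctx Γ ⟶ T.generic.srt σ))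
    (h : ∀ σ v, T.toGeneric Γ ≫ g σ v = T.arrow (Subst.single (γ σ v))) :
    T.toGeneric Γ ≫ T.generic.tuple g = T.arrow γ ≫ T.toGeneric Δ :=
  T.generic.ctx_hom_ext fun σ v => by
    rw [Category.assoc, Category.assoc, Str.tuple_proj, h, toGeneric_proj]
    exact congrArg T.arrow (Subst.comp_single γ (.var v)).symm

/-- The interpretation of a term in the generic structure is its class. -/
theorem toGeneric_term {Γ : List Sg.Srt} {σ : Sg.Srt} (M : Term Sg Γ σ) :
    T.toGeneric Γ ≫ T.generic.term M = T.arrow (Subst.single M) := by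
  induction M with
  | var v => exact T.toGeneric_proj v
  | @app as τ f args ih =>
    have h := T.toGeneric_tuple args (fun σ v => T.generic.term (args σ v)) ih
    have h' : T.toGeneric as ≫ T.generic.fn f = T.arrow (Subst.single (.app f (Subst.id as))) :=
      IsIso.hom_inv_id_assoc (T.ctxIso as) _
    refine (Category.assoc (T.toGeneric Γ) (T.generic.terms args) (T.generic.fn f)).symm.trans ?_
    refine (congrArg (· ≫ T.generic.fn f) h).trans ((Category.assoc _ _ _).trans ?_)
    refine (congrArg (T.arrow args ≫ ·) h').trans ?_
    exact congrArg T.arrow (Subst.comp_single args _)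

theorem toGeneric_terms {Γ Δ : List Sg.Srt} (γ : Subst Sg Γ Δ) :
    T.toGeneric Γ ≫ T.generic.terms γ = T.arrow γ ≫ T.toGeneric Δ :=
  T.toGeneric_tuple γ _ fun σ v => T.toGeneric_term (γ σ v)

/-- The interpretation of a formula in the generic structure is its class. -/
theorem reindex_toGeneric : ∀ {Γ : List Sg.Srt} (φ : Formula L Sg Γ),
    T.classifying.reindex (T.toGeneric Γ) (T.generic.formula φ) = T.pred φ
  | Γ, .rel (as := as) R args => by
    refine (T.classifying.reindex_comp _ _ _).symm.trans ?_
    refine (congrArg (fun f => T.classifying.reindex f (T.generic.rel R))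
      (T.toGeneric_terms args)).trans ((T.classifying.reindex_comp _ _ _).trans ?_)
    have h : T.classifying.reindex (T.toGeneric as) (T.generic.rel R) =
        T.pred (.rel R (Subst.id as)) := by
      refine (T.classifying.reindex_comp (T.ctxIso as) (inv (T.ctxIso as)) _).symm.trans ?_
      rw [IsIso.hom_inv_id]
      exact T.classifying.reindex_id _
    exact congrArg (T.classifying.reindex (T.arrow args)) h
  | Γ, .eq (τ := τ) M N => by
    refine (T.classifying.reindex_comp _ _ _).symm.trans ?_
    refine (congrArg (fun f => T.classifying.reindex f (T.classifying.eqPred (T.obj [τ])))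
      ((comp_lift _ _ _).trans
        (congrArg₂ lift (T.toGeneric_term M) (T.toGeneric_term N)))).trans ?_
    refine (T.reindex_eqPred _ _).trans ?_
    exact T.cls_unit_tens (Γ := ⟨Γ⟩) (.eq M N)
  | Γ, .conn k φ => by
    refine (T.classifying.reindex_conn k _ _).trans ?_
    refine (congrArg (T.classifying.conn k (T.obj Γ))
      (funext fun i => reindex_toGeneric (φ i))).trans ?_
    exact T.conn_cls k (Γ := ⟨Γ⟩) φ
  | Γ, .quant q σ φ => by
    refine (T.classifying.quant_natural q (T.ctxIso Γ) (T.obj [σ]) _).symm.trans ?_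
    exact congrArg (T.classifying.quant q (T.obj Γ) (T.obj [σ])) (reindex_toGeneric φ)

/-- The generic structure satisfies exactly the assertions of the theory. -/
theorem generic_satisfies_iff {a : Assertion L Sg} : T.generic.Satisfies a ↔ a ∈ T.carrier := by
  cases a with
  | @eqn Γ τ M N =>
    refine (cancel_epi (T.toGeneric Γ)).symm.trans ?_
    rw [toGeneric_term, toGeneric_term]
    refine arrow_eq_iff.trans ⟨fun h => h _ .zero, fun h σ v => ?_⟩
    cases v with
    | zero => exact h
    | succ v => exact nomatch v
  | @seq Γ Φ ψ =>
    refine (T.classifying.reindex_le_iff (T.toGeneric Γ)).symm.trans ?_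
    rw [PropCat.reindex_tensAll, List.map_map, reindex_toGeneric]
    rw [show T.classifying.reindex (T.toGeneric Γ) ∘ T.generic.formula = T.pred from
      funext T.reindex_toGeneric]
    exact T.tensAll_map_pred_le_iff

end MinimalTheory

/-! ### Morphisms into and out of products -/

namespace PropCat

namespace Hom

variable {I : Type u} (B : I → PropCat.{u} L)

/-- The functor underlying the projection from a product of prop-categories. -/
def evalFunctor (i : I) : (pi B).Obj ⥤ (B i).Obj := Pi.eval (fun i => (B i).Obj) i

theorem prodComparison_evalFunctor (i : I) (b c : (pi B).Obj) :
    prodComparison (evalFunctor B i) b c = 𝟙 ((evalFunctor B i).obj (b ⊗ c)) :=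
  lift_fst_snd (X := b i) (Y := c i)

instance (i : I) (b c : (pi B).Obj) : IsIso (prodComparison (evalFunctor B i) b c) :=
  ⟨𝟙 ((evalFunctor B i).obj (b ⊗ c)),
    (Category.comp_id _).trans (prodComparison_evalFunctor B i b c),
    (Category.id_comp _).trans (prodComparison_evalFunctor B i b c)⟩

instance (i : I) : IsIso (terminalComparison (evalFunctor B i)) :=
  ⟨𝟙 (𝟙_ (B i).Obj), toUnit_unique _ _, toUnit_unique _ _⟩

/-- The projection from a product of prop-categories. -/
def eval (i : I) : Hom (pi B) (B i) where
  functor := evalFunctor B i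
  preserves := preservesFiniteProducts_of_isIso_comparison _
  app c := ⟨fun r => r i, fun _ _ h => h i⟩
  naturality _ _ := rfl
  app_conn _ _ _ := rfl
  app_quant q b c r := by
    refine congrArg ((B i).quant q (b i) (c i)) ?_
    have h : inv (prodComparison (evalFunctor B i) b c) = 𝟙 ((evalFunctor B i).obj (b ⊗ c)) :=
      IsIso.inv_eq_of_hom_inv_id
        ((Category.comp_id _).trans (prodComparison_evalFunctor B i b c))
    refine Eq.trans ?_ (congrArg (fun f => (B i).reindex f (r i)) h).symm
    exact ((B i).reindex_id _).symm
  app_eqPred c := by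
    refine Eq.trans ?_ (congrArg (fun f => (B i).reindex f ((B i).eqPred (c i)))
      (prodComparison_evalFunctor B i c c)).symm
    exact ((B i).reindex_id _).symm

theorem jointlyConservative_eval : JointlyConservative (eval B) where
  faithful _ _ h := funext h
  reflects _ _ h := h

variable {B} {A : PropCat.{u} L} (F : ∀ i, Hom A (B i))

/-- The functor into a product given by a family of morphisms. -/
def pairFunctor : A.Obj ⥤ (pi B).Obj := Functor.pi' fun i => (F i).functor

/-- The inverse of the comparison of products for a functor into a product. -/
def pairComparisonInv (b c : A.Obj) :
    (pairFunctor F).obj b ⊗ (pairFunctor F).obj c ⟶ (pairFunctor F).obj (b ⊗ c) :=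
  fun i => (inv (prodComparison (F i).functor b c) :
    (F i).functor.obj b ⊗ (F i).functor.obj c ⟶ (F i).functor.obj (b ⊗ c))

theorem prodComparison_comp_pairComparisonInv (b c : A.Obj) :
    prodComparison (pairFunctor F) b c ≫ pairComparisonInv F b c = 𝟙 _ :=
  funext fun i => IsIso.hom_inv_id (prodComparison (F i).functor b c)

instance (b c : A.Obj) : IsIso (prodComparison (pairFunctor F) b c) :=
  ⟨pairComparisonInv F b c, prodComparison_comp_pairComparisonInv F b c,
    funext fun i => IsIso.inv_hom_id (prodComparison (F i).functor b c)⟩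

instance : IsIso (terminalComparison (pairFunctor F)) :=
  ⟨fun i => (inv (terminalComparison (F i).functor) :
      𝟙_ (B i).Obj ⟶ (F i).functor.obj (𝟙_ A.Obj)),
    funext fun i => IsIso.hom_inv_id (terminalComparison (F i).functor),
    funext fun i => IsIso.inv_hom_id (terminalComparison (F i).functor)⟩

/-- The morphism into a product of prop-categories given by a family of morphisms. -/
def pair : Hom A (pi B) where
  functor := pairFunctor F
  preserves := preservesFiniteProducts_of_isIso_comparison _
  app c := ⟨fun r i => (F i).app c r, fun _ _ h i => ((F i).app c).monotone h⟩
  naturality f r := funext fun i => (F i).naturality f r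
  app_conn k c r := funext fun i => (F i).app_conn k c r
  app_quant q b c r := by
    have h : inv (prodComparison (pairFunctor F) b c) = pairComparisonInv F b c :=
      IsIso.inv_eq_of_hom_inv_id (prodComparison_comp_pairComparisonInv F b c)
    rw [h]
    exact funext fun i => (F i).app_quant q b c r
  app_eqPred c := funext fun i => (F i).app_eqPred c

end Hom

/-- A jointly conservative family of morphisms embeds its source into the product of its targets. -/
theorem isSubpropCategory_pi {I : Type u} {A : PropCat.{u} L} {B : I → PropCat.{u} L}
    {F : ∀ i, Hom A (B i)} (hF : Hom.JointlyConservative F) : A.IsSubpropCategory (pi B) :=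
  ⟨Hom.pair F, ⟨fun {_ _ f g} h => hF.faithful f g fun i => congrFun h i⟩,
    fun _ r s => ⟨fun h => hF.reflects r s h, fun h => ((Hom.pair F).app _).monotone h⟩⟩

/-- A single morphism, as a one-element family, is jointly conservative if it exhibits a
subprop-category. -/
theorem Hom.jointlyConservative_of_faithful {A B : PropCat.{u} L} (F : Hom A B)
    (h : F.functor.Faithful) (h' : ∀ (d : A.Obj) (r s : A.Pred d),
      F.app d r ≤ F.app d s ↔ r ≤ s) :
    Hom.JointlyConservative (fun _ : PUnit.{u + 1} => F) where
  faithful _ _ e := h.map_injective (e ⟨⟩)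
  reflects r s e := (h' _ r s).1 (e ⟨⟩)

end PropCat

/-! ### Sound prop-categories -/

/-- Soundness for `⊨_X` only has to be tested on the theories of structures and on single
assertions. -/
theorem mem_soundClass_iff {X : Set (PropCat.{u} L)} {A : PropCat.{u} L} :
    A ∈ soundClass (semanticLogic X) ↔ ∀ (Sg : Signature.{u}) (S : Str Sg A)
      (a : Assertion L Sg), (∀ B ∈ X, ∀ S' : Str Sg B, S'.IsModel S.theory → S'.Satisfies a) →
        S.Satisfies a := by
  constructor
  · intro h Sg S a ha
    refine h Sg S.theory {a} ?_ A rfl S le_rfl rfl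
    rintro _ rfl
    exact ha
  · rintro h Sg T T' hT B rfl S hS a ha
    exact h Sg S a fun B hB S' hS' => hT ha B hB S' (le_trans hS hS')

theorem subset_soundClass (X : Set (PropCat.{u} L)) : X ⊆ soundClass (semanticLogic X) :=
  fun _ hA => mem_soundClass_iff.2 fun _ S _ h => h _ hA S le_rfl

/-- Soundness passes backwards along jointly conservative families of morphisms. -/
theorem mem_soundClass_of_jointlyConservative {X : Set (PropCat.{u} L)} {I : Type u}
    {A : PropCat.{u} L} {B : I → PropCat.{u} L} {F : ∀ i, PropCat.Hom A (B i)}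
    (hF : PropCat.Hom.JointlyConservative F) (hB : ∀ i, B i ∈ soundClass (semanticLogic X)) :
    A ∈ soundClass (semanticLogic X) :=
  mem_soundClass_iff.2 fun Sg S a h => hF.satisfies S fun i =>
    mem_soundClass_iff.1 (hB i) Sg _ a fun C hC S' hS' =>
      h C hC S' fun _ hb => hS' ((F i).mapStr_satisfies S hb)

theorem prodClosure_subset_soundClass {X : Set (PropCat.{u} L)} :
    ProdClosure X ⊆ soundClass (semanticLogic X) := by
  intro A hA
  induction hA with
  | base A h => exact subset_soundClass X h
  | prod A _ ih =>
    exact mem_soundClass_of_jointlyConservative (PropCat.Hom.jointlyConservative_eval A) ih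

theorem subClosure_prodClosure_subset_soundClass {X : Set (PropCat.{u} L)} :
    SubClosure (ProdClosure X) ⊆ soundClass (semanticLogic X) := by
  intro A hA
  induction hA with
  | base A h => exact prodClosure_subset_soundClass h
  | sub _ hB ih =>
    obtain ⟨F, hF, hF'⟩ := hB
    exact mem_soundClass_of_jointlyConservative (F.jointlyConservative_of_faithful hF hF')
      fun _ => ih

/-- A structure exhibits the classifying prop-category of its theory as a subprop-category. -/
theorem classifying_isSubpropCategory {A : PropCat.{u} L} (S : Str Sg A) :
    S.minimalTheory.classifying.IsSubpropCategory A := by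
  have hF := S.minimalTheory.jointlyConservative_modelHom (I := PUnit.{u + 1}) (S := fun _ => S)
    (fun _ => le_rfl) (fun a h => h ⟨⟩)
  exact ⟨S.minimalTheory.modelHom le_rfl, ⟨fun {_ _ f g} h => hF.faithful f g fun _ => h⟩,
    fun _ r s => ⟨fun h => hF.reflects r s fun _ => h, fun h => OrderHom.monotone _ h⟩⟩

/-- A classifying prop-category that is sound for `⊨_X` is a subprop-category of a product of
members of `X`: for every assertion outside the theory choose a model in a member of `X` that
refutes it, and take the product of the chosen members. -/
theorem classifying_mem_subClosure {X : Set (PropCat.{u} L)} (T : MinimalTheory L Sg)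
    (hT : T.classifying ∈ soundClass (semanticLogic X)) :
    T.classifying ∈ SubClosure (ProdClosure X) := by
  have hsep : ∀ a : {a : Assertion L Sg // a ∉ T.carrier}, ∃ B ∈ X, ∃ S : Str Sg B,
      S.IsModel T.carrier ∧ ¬ S.Satisfies a.1 := by
    rintro ⟨a, ha⟩
    by_contra! hne
    refine ha (T.generic_satisfies_iff.1 (mem_soundClass_iff.1 hT Sg T.generic a ?_))
    exact fun B hB S hS => hne B hB S fun b hb => hS (T.generic_satisfies_iff.2 hb)
  choose B hB S hS hSa using hsep
  -- The index set, the complement of the theory, is small.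
  refine .sub (.base _ (.prod B fun a => .base _ (hB a))) (PropCat.isSubpropCategory_pi
    (T.jointlyConservative_modelHom hS fun a h => ?_))
  by_contra ha
  exact hSa ⟨a, ha⟩ (h ⟨a, ha⟩)

/-- The theory of a structure is the theory of the generic structure of its classifying
prop-category, so soundness of a prop-category depends only on its classifying
subprop-categories. -/
theorem soundClass_eq_classifyingClosure (X : Set (PropCat.{u} L)) :
    soundClass (semanticLogic X) = classifyingClosure (SubClosure (ProdClosure X)) := by
  ext A
  constructor
  · rintro hA Sg T ⟨F, hF, hF'⟩
    exact classifying_mem_subClosure T (mem_soundClass_of_jointlyConservative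
      (F.jointlyConservative_of_faithful hF hF') fun _ => hA)
  · refine fun hA => mem_soundClass_iff.2 fun Sg S a h => ?_
    have hG := mem_soundClass_iff.1 (subClosure_prodClosure_subset_soundClass
      (hA Sg S.minimalTheory (classifying_isSubpropCategory S)))
    refine S.minimalTheory.generic_satisfies_iff.1 (hG Sg _ a fun B hB S' hS' => ?_)
    exact h B hB S' fun b hb => hS' (S.minimalTheory.generic_satisfies_iff.2 hb)

theorem semanticLogic_soundClass (X : Set (PropCat.{u} L)) :
    semanticLogic (soundClass (semanticLogic X)) = semanticLogic X := by
  funext Sg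
  refine ClosureOperator.ext _ _ fun T => Set.Subset.antisymm ?_ ?_
  · exact fun a ha A hA S hS => ha A (subset_soundClass X hA) S hS
  · rintro a ha A hA S hS
    refine hA Sg T {a} ?_ A rfl S hS rfl
    rintro _ rfl
    exact ha

end

end FiberedLogic

theorem mainTheorem2 (L : FiberedLogic.FOLanguage.{u})
    (X : Set (FiberedLogic.PropCat.{u} L)) :
    FiberedLogic.soundClass (FiberedLogic.semanticLogic X) =
        FiberedLogic.classifyingClosure
          (FiberedLogic.SubClosure (FiberedLogic.ProdClosure X)) ∧
      IsGreatest
        {Y : Set (FiberedLogic.PropCat.{u} L) |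
          FiberedLogic.semanticLogic Y = FiberedLogic.semanticLogic X}
        (FiberedLogic.classifyingClosure
          (FiberedLogic.SubClosure (FiberedLogic.ProdClosure X))) := by
  rw [← FiberedLogic.soundClass_eq_classifyingClosure X]
  refine ⟨rfl, FiberedLogic.semanticLogic_soundClass X, fun Y hY => ?_⟩
  have hYX : FiberedLogic.semanticLogic Y = FiberedLogic.semanticLogic X := hY
  rw [← hYX]
  exact FiberedLogic.subset_soundClass Y
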